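/- **Setting.** Let $d\ge 1$, $T>0$, $\theta>0$, and let $\Lambda=(\mathbb R/\mathbb Z)^d$ with Lebesgue measure. Let $J\in C^1(\Lambda)$ be real-valued, of any sign, with $J(-r)=J(r)$ and $\int_\Lambda J(r)\,dr=1$. Let $a_1\neq a_2$ be real numbers and $p_1,p_2\ge 0$ with $p_1+p_2=1$. Let $\alpha=(\alpha(x))_{x\in\mathbb Z^d}$ be i.i.d. with $\mathbb P(\alpha(x)=a_i)=p_i$, $i=1,2$. For $\gamma\in(0,1]$ with $\gamma^{-1}$ an odd integer let $\Lambda_\gamma=\mathbb Z^d/\gamma^{-1}\mathbb Z^d$, identified with $\{-\frac{\gamma^{-1}-1}{2},\dots,\frac{\gamma^{-1}-1}{2}\}^d$, so that $\alpha$ restricts to a field on $\Lambda_\gamma$, and let $\mathcal S_\gamma=\{-1,+1\}^{\Lambda_\gamma}$. Put $$H^{\gamma,\alpha}(\sigma)=-\tfrac12\sum_{x,y\in\Lambda_\gamma}\gamma^dJ(\gamma(x-y))\sigma(x)\sigma(y)-\theta\sum_{x\in\Lambda_\gamma}\alpha(x)\sigma(x),\qquad c_x(\sigma)=\frac{e^{-\frac12(H^{\gamma,\alpha}(\sigma^x)-H^{\gamma,\alpha}(\sigma))}}{2\cosh\!\big(\frac12(H^{\gamma,\alpha}(\sigma^x)-H^{\gamma,\alpha}(\sigma))\big)},$$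 where $\sigma^x$ is $\sigma$ with the spin at $x$ flipped. Let $m_0:\Lambda\to[-1,1]$ be continuous and let $(\sigma^\gamma)_\gamma$, $\sigma^\gamma\in\mathcal S_\gamma$, be deterministic configurations (not depending on $\alpha$) such that $\gamma^d\sum_{x\in\Lambda_\gamma}G(\gamma x)\sigma^\gamma(x)\to\int_\Lambda G\,m_0\,dr$ as $\gamma\to0$ for every $G\in C(\Lambda)$. Let $P^{\gamma,\alpha}_{\sigma^\gamma}$ be the law on the càdlàg space $D([0,T],\mathcal S_\gamma)$ of the Markov process $(\sigma_t)_{t\in[0,T]}$ with $\sigma_0=\sigma^\gamma$ and generator $\mathcal L f(\sigma)=\sum_{x\in\Lambda_\gamma}c_x(\sigma)[f(\sigma^x)-f(\sigma)]$. Let $\overline m=(m_1,m_2)$ be the unique bounded weak solution on $[0,T]\times\Lambda$ of $$\partial_t m_i=-m_i+p_i\tanh\big[J*m+a_i\theta\big],\qquad m=m_1+m_2,\qquad m_i(0,\cdot)=p_im_0,\qquad i=1,2,$$ that is, $\int g\,m_i(t,\cdot)\,dr=\int g\,p_im_0\,dr+\int_0^t\!\int g\,\{-m_i+p_i\tanh[J*m+a_i\theta]\}\,dr\,ds$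 for all $g\in C(\Lambda)$, $t\in[0,T]$, $i=1,2$. For $\overline G=(G_1,G_2)$ write $$\langle\overline\pi^\gamma_t,\overline G(t,\cdot)\rangle=\sum_{i=1,2}\gamma^d\sum_{x\in\Lambda_\gamma}G_i(t,\gamma x)\mathbf 1_{\{\alpha(x)=a_i\}}\sigma_t(x),\qquad \langle\overline m(t,\cdot),\overline G(t,\cdot)\rangle=\sum_{i=1,2}\int_\Lambda G_i(t,r)m_i(t,r)\,dr .$$ **Statement.** For $\mathbb P$-almost every $\alpha$: for all $G_1,G_2\in C^{0,1}([0,T]\times\Lambda)$ (that is, continuous on $[0,T]\times\Lambda$, and continuously differentiable in $r\in\Lambda$ for every $t$) and all $\delta>0$, $$\lim_{\gamma\to0}P^{\gamma,\alpha}_{\sigma^\gamma}\Big[\sup_{t\in[0,T]}\big|\langle\overline\pi^\gamma_t,\overline G(t,\cdot)\rangle-\langle\overline m(t,\cdot),\overline G(t,\cdot)\rangle\big|\ge\delta\Big]=0,$$ where $\gamma\to0$ along the values with $\gamma^{-1}$ an odd integer. -/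

import Mathlib

open MeasureTheory ProbabilityTheory Filter Topology

namespace KacGlauber

noncomputable section

/-- The macroscopic torus `Λ = (ℝ / ℤ)^d`. Its `volume` is Lebesgue measure, of total mass one. -/
abbrev Torus (d : ℕ) : Type := Fin d → UnitAddCircle

/-- The space `C¹(Λ)`: a function on the torus is continuously differentiable when its periodic lift
to `ℝ^d` is. -/
def IsC1 {d : ℕ} (f : Torus d → ℝ) : Prop :=
  ContDiff ℝ 1 (fun x : Fin d → ℝ => f (fun i => ((x i : ℝ) : UnitAddCircle)))

/-- The time interval `[0,T]`. -/
abbrev Time (T : ℝ) : Type := Set.Icc (0 : ℝ) T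

/-- The initial time. -/
def timeZero {T : ℝ} (hT : 0 < T) : Time T := ⟨0, Set.left_mem_Icc.2 hT.le⟩

/-- The integral `∫_0^t F(s) ds` of a function on `[0,T]`, for `t ∈ [0,T]` (the projection to `[0,T]`
is the identity on the domain of integration). -/
def timeIntegral {T : ℝ} (F : Time T → ℝ) (t : Time T) : ℝ :=
  ∫ s in (0 : ℝ)..(t : ℝ), F (Set.projIcc 0 T (t.2.1.trans t.2.2) s)

/-- The space `C^{0,1}([0,T] × Λ)`: continuous functions of `(t,r)` that are continuously
differentiable in `r` for every `t`. -/
def IsC01 {d : ℕ} {T : ℝ} (G : Time T → Torus d → ℝ) : Prop :=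
  Continuous (fun q : Time T × Torus d => G q.1 q.2) ∧ ∀ t, IsC1 (G t)

/-- The discrete torus `Λ_γ = ℤ^d / n ℤ^d`, where `n = γ⁻¹`. -/
abbrev Site (d n : ℕ) : Type := Fin d → ZMod n

/-- Spin configurations `{-1,+1}^{Λ_γ}`. -/
abbrev Config (d n : ℕ) : Type := Site d n → ℤˣ

/-- The value `±1` of a spin as a real number. -/
def spin {d n : ℕ} (σ : Config d n) (x : Site d n) : ℝ := ((σ x : ℤ) : ℝ)

/-- The macroscopic position `γ x ∈ Λ` of the site `x ∈ Λ_γ`. -/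
def toTorus {d n : ℕ} [NeZero n] (x : Site d n) : Torus d := fun i => ZMod.toAddCircle (x i)

/-- The configuration `σ^x`, in which the spin at `x` is flipped. -/
def flip {d n : ℕ} (σ : Config d n) (x : Site d n) : Config d n :=
  Function.update σ x (-σ x)

/-- The field on `Λ_γ` induced by a field on `ℤ^d`: for odd `n`, sites of `Λ_γ` are represented by
the integer points of the centred box `[-(n-1)/2, (n-1)/2]^d`. -/
def latticeField {d : ℕ} (n : ℕ) (α : (Fin d → ℤ) → ℝ) (x : Site d n) : ℝ :=
  α (fun i => (x i).valMinAbs)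

/-- The law `p₁ δ_{a₁} + p₂ δ_{a₂}` of the field at one site. -/
def siteLaw (a p : Fin 2 → ℝ) : Measure ℝ :=
  ∑ i, ENNReal.ofReal (p i) • Measure.dirac (a i)

/-- The law `ℙ` of the disorder: the field is i.i.d. over `ℤ^d`. -/
def disorderLaw (d : ℕ) (a p : Fin 2 → ℝ) : Measure ((Fin d → ℤ) → ℝ) :=
  Measure.infinitePi (fun _ => siteLaw a p)

theorem isProbabilityMeasure_siteLaw (a p : Fin 2 → ℝ) (hp : ∀ i, 0 ≤ p i)
    (hp1 : p 0 + p 1 = 1) : IsProbabilityMeasure (siteLaw a p) := by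
  constructor
  simp [siteLaw, Fin.sum_univ_two, ← ENNReal.ofReal_add (hp 0) (hp 1), hp1]

theorem isProbabilityMeasure_disorderLaw (d : ℕ) (a p : Fin 2 → ℝ) (hp : ∀ i, 0 ≤ p i)
    (hp1 : p 0 + p 1 = 1) : IsProbabilityMeasure (disorderLaw d a p) := by
  have := isProbabilityMeasure_siteLaw a p hp hp1
  unfold disorderLaw
  infer_instance

section Dynamics

variable {d n : ℕ} [NeZero n]

/-- The Kac potential `J_γ(x,y) = γ^d J(γ(x-y))`, with `γ = 1/n`. -/
def kac (J : Torus d → ℝ) (x y : Site d n) : ℝ :=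
  ((n : ℝ)⁻¹) ^ d * J (toTorus (x - y))

/-- The Hamiltonian `H^{γ,α}(σ)`. -/
def energy (J : Torus d → ℝ) (θ : ℝ) (α : (Fin d → ℤ) → ℝ) (σ : Config d n) : ℝ :=
  -(1 / 2) * ∑ x, ∑ y, kac J x y * spin σ x * spin σ y
    - θ * ∑ x, latticeField n α x * spin σ x

/-- The Glauber flip rate `c_x^{γ,α}(σ)`, at inverse temperature `β = 1`. -/
def flipRate (J : Torus d → ℝ) (θ : ℝ) (α : (Fin d → ℤ) → ℝ) (x : Site d n)
    (σ : Config d n) : ℝ :=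
  Real.exp (-(1 / 2) * (energy J θ α (flip σ x) - energy J θ α σ)) /
    (2 * Real.cosh ((1 / 2) * (energy J θ α (flip σ x) - energy J θ α σ)))

/-- The generator `𝓛^{γ,α}`. -/
def generator (J : Torus d → ℝ) (θ : ℝ) (α : (Fin d → ℤ) → ℝ) (f : Config d n → ℝ)
    (σ : Config d n) : ℝ :=
  ∑ x, flipRate J θ α x σ * (f (flip σ x) - f σ)

end Dynamics

/-- The path space `D([0,T], S)` for a discrete space `S`: right continuous paths with left limits.
A limit in a discrete space means that the path is eventually constant. -/
def PathSpace (T : ℝ) (S : Type) : Type :=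
  {w : Time T → S // ∀ t : Time T,
    (∀ᶠ s in 𝓝[>] t, w s = w t) ∧ ∃ c : S, ∀ᶠ s in 𝓝[<] t, w s = c}

/-- The `σ`-algebra on the path space generated by the evaluations `w ↦ w t`. -/
instance (T : ℝ) (S : Type) : MeasurableSpace (PathSpace T S) :=
  ⨆ t : Time T, MeasurableSpace.comap (fun w : PathSpace T S => w.1 t) ⊤

/-- The canonical filtration: the `σ`-algebra at time `t` is generated by the evaluations at the
times `s ≤ t`. -/
def canonicalFiltration (T : ℝ) (S : Type) :
    Filtration (Time T) (inferInstance : MeasurableSpace (PathSpace T S)) where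
  seq t := ⨆ s : Set.Iic t, MeasurableSpace.comap (fun w : PathSpace T S => w.1 s.1) ⊤
  mono' _ _ h := iSup_le fun s =>
    le_iSup (fun u : Set.Iic _ => MeasurableSpace.comap (fun w : PathSpace T S => w.1 u.1) ⊤)
      ⟨s.1, le_trans s.2 h⟩
  le' _ := iSup_le fun s =>
    le_iSup (fun u : Time T => MeasurableSpace.comap (fun w : PathSpace T S => w.1 u) ⊤) s.1

/-- `μ` is the law `P^{γ,α}_{σ₀}` on `D([0,T], S_γ)` of the Markov process with generator
`𝓛^{γ,α}` started from `σ₀`, as the solution of the martingale problem: for every `f`, the process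
`f(σ_t) - f(σ_0) - ∫_0^t 𝓛 f(σ_s) ds` is a martingale for the canonical filtration. -/
structure IsGlauberLaw {d n : ℕ} [NeZero n] {T : ℝ} (hT : 0 < T) (J : Torus d → ℝ) (θ : ℝ)
    (α : (Fin d → ℤ) → ℝ) (σ₀ : Config d n) (μ : Measure (PathSpace T (Config d n))) : Prop where
  isProbabilityMeasure : IsProbabilityMeasure μ
  initial : ∀ᵐ w ∂μ, w.1 (timeZero hT) = σ₀
  martingale : ∀ f : Config d n → ℝ,
    Martingale
      (fun (t : Time T) (w : PathSpace T (Config d n)) =>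
        f (w.1 t) - f (w.1 (timeZero hT)) - timeIntegral (fun s => generator J θ α f (w.1 s)) t)
      (canonicalFiltration T (Config d n)) μ

/-- The pairing `⟨π^γ(σ), G⟩ = γ^d ∑_x G(γx) σ(x)`. -/
def empirical {d n : ℕ} [NeZero n] (σ : Config d n) (G : Torus d → ℝ) : ℝ :=
  ((n : ℝ)⁻¹) ^ d * ∑ x, G (toTorus x) * spin σ x

open Classical in
/-- The indicator `α_i(x)` that the field at the site `x ∈ Λ_γ` takes the value `a_i`. -/
def colour {d : ℕ} (n : ℕ) (a : Fin 2 → ℝ) (α : (Fin d → ℤ) → ℝ) (i : Fin 2) (x : Site d n) : ℝ :=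
  if latticeField n α x = a i then 1 else 0

/-- The pairing `⟨π̄^γ(σ), Ḡ⟩ = ∑_i γ^d ∑_x G_i(γx) α_i(x) σ(x)` of the coloured empirical
measures. -/
def colouredEmpirical {d n : ℕ} [NeZero n] (a : Fin 2 → ℝ) (α : (Fin d → ℤ) → ℝ) (σ : Config d n)
    (G : Fin 2 → Torus d → ℝ) : ℝ :=
  ∑ i, ((n : ℝ)⁻¹) ^ d * ∑ x, G i (toTorus x) * colour n a α i x * spin σ x

/-- The pairing `⟨m̄, Ḡ⟩ = ∑_i ∫ G_i m_i`. -/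
def pairing {d : ℕ} (m G : Fin 2 → Torus d → ℝ) : ℝ :=
  ∑ i, ∫ r, G i r * m i r

/-- The convolution `(J * u)(r) = ∫ J(r - r') u(r') dr'` on the torus. -/
def conv {d : ℕ} (J u : Torus d → ℝ) (r : Torus d) : ℝ :=
  ∫ r', J (r - r') * u r'

/-- `m̄ = (m₁, m₂)` is a (bounded) weak solution on `[0,T] × Λ` of
`∂_t m_i = - m_i + p_i tanh (J * m + a_i θ)`, `m = m₁ + m₂`, `m_i(0,·) = p_i m₀`. -/
structure IsWeakSolution {d : ℕ} {T : ℝ} (J : Torus d → ℝ) (θ : ℝ) (a p : Fin 2 → ℝ)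
    (m₀ : Torus d → ℝ) (m : Fin 2 → Time T → Torus d → ℝ) : Prop where
  measurable : ∀ i, Measurable (fun q : Time T × Torus d => m i q.1 q.2)
  bounded : ∃ C : ℝ, ∀ i t, ∀ᵐ r, |m i t r| ≤ C
  weak : ∀ (i : Fin 2) (g : Torus d → ℝ), Continuous g → ∀ t : Time T,
    ∫ r, g r * m i t r = (∫ r, g r * (p i * m₀ r)) +
      timeIntegral (fun s => ∫ r, g r *
        (-m i s r + p i * Real.tanh (conv J (fun r' => m 0 s r' + m 1 s r') r + a i * θ))) t

end

end KacGlauber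

/-! For a test function $g$ and a colour $i$, the coloured average $\pi_i(g)$ (`colourMean`) solves,
up to a Dynkin martingale, an integral equation with drift $-\pi_i(g)+\gamma^d\sum_x g(\gamma
x)\alpha_i(x)\tanh(h_x+\theta\alpha(x))$ (`generator_colourMean`). Three facts turn this into a
small perturbation of the weak equation for $\overline m$.

The martingale vanishes uniformly in time: its carré du champ is $O(\gamma^d)$, so an $L^2$ bound at
time $T$ and Doob's inequality suffice (`IsGlauberLaw.measure_exists_lt_abs_dynkin_le`).

The drift closes, uniformly over all configurations: it is close to $-\pi_i(g)+p_i\int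
g\tanh(J*\pi+a_i\theta)$. The configuration enters the nonlinearity only through $J*\pi$, and these
fields form a totally bounded set in $C(\Lambda)$, so up to a small error only finitely many
continuous fields matter, and each is handled by the law of large numbers for $\alpha$
(`eventually_forall_abs_colourDrift_sub_le`). No local equilibrium argument is needed.

The law of large numbers holds off one null set, by Hoeffding's inequality, Borel–Cantelli and
separability of $C(\Lambda)$ (`ae_forall_tendsto_siteMean_centred`). It also gives the initial
condition, because $\sigma^\gamma$ does not depend on $\alpha$.

The rest is deterministic. On a finite set $F$ of test functions containing $\varepsilon$-nets of
$\{J(r-\cdot)\}$ and of $\{G_i(t,\cdot)\}$, the deviations $\pi_i(g)-\int g\,m_i$ satisfy a closed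
Gronwall inequality, since $J*\pi-J*m$ is controlled by these same deviations
(`abs_colourMean_sub_le_stabilityConst`). The probability is then at most a finite sum over $F$ of
martingale tail bounds. -/

namespace KacGlauber

noncomputable section

/-! ### Averages over the discrete torus -/

section SiteMean

variable {d n : ℕ} [NeZero n]

/-- The average `γ^d ∑_x F(x)` over the discrete torus. -/
def siteMean (F : Site d n → ℝ) : ℝ := ((n : ℝ)⁻¹) ^ d * ∑ x, F x

theorem card_site : (Fintype.card (Site d n) : ℝ) = (n : ℝ) ^ d := by
  simp [ZMod.card]

theorem siteMean_const (c : ℝ) : siteMean (fun _ : Site d n => c) = c := by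
  have hn : (n : ℝ) ≠ 0 := NeZero.ne _
  simp only [siteMean, Finset.sum_const, Finset.card_univ, nsmul_eq_mul, card_site]
  rw [← mul_assoc, ← mul_pow, inv_mul_cancel₀ hn, one_pow, one_mul]

theorem siteMean_add (F F' : Site d n → ℝ) :
    siteMean (fun x => F x + F' x) = siteMean F + siteMean F' := by
  simp [siteMean, Finset.sum_add_distrib, mul_add]

theorem siteMean_sub (F F' : Site d n → ℝ) :
    siteMean (fun x => F x - F' x) = siteMean F - siteMean F' := by
  simp [siteMean, Finset.sum_sub_distrib, mul_sub]

theorem siteMean_const_mul (c : ℝ) (F : Site d n → ℝ) :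
    siteMean (fun x => c * F x) = c * siteMean F := by
  simp only [siteMean, ← Finset.mul_sum]; ring

theorem siteMean_mono {F F' : Site d n → ℝ} (h : ∀ x, F x ≤ F' x) : siteMean F ≤ siteMean F' :=
  mul_le_mul_of_nonneg_left (Finset.sum_le_sum fun x _ => h x) (by positivity)

theorem abs_siteMean_le {F : Site d n → ℝ} {C : ℝ} (h : ∀ x, |F x| ≤ C) : |siteMean F| ≤ C := by
  rw [abs_le]
  constructor
  · rw [← siteMean_const (d := d) (n := n) (-C)]
    exact siteMean_mono fun x => (abs_le.1 (h x)).1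
  · rw [← siteMean_const (d := d) (n := n) C]
    exact siteMean_mono fun x => (abs_le.1 (h x)).2

theorem abs_siteMean_sub_le {F F' : Site d n → ℝ} {C : ℝ} (h : ∀ x, |F x - F' x| ≤ C) :
    |siteMean F - siteMean F'| ≤ C := by
  rw [← siteMean_sub]; exact abs_siteMean_le h

end SiteMean

instance isProbabilityMeasure_unitAddCircle :
    IsProbabilityMeasure (volume : Measure UnitAddCircle) :=
  ⟨by simp [AddCircle.measure_univ]⟩

instance isProbabilityMeasure_torus (d : ℕ) : IsProbabilityMeasure (volume : Measure (Torus d)) :=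
  inferInstanceAs (IsProbabilityMeasure (Measure.pi fun _ => volume))

/-! ### Riemann sums on the torus -/

theorem toTorus_add {d n : ℕ} [NeZero n] (x y : Site d n) :
    toTorus (x + y) = toTorus x + toTorus y := by
  funext i; simp [toTorus]

theorem toTorus_sub {d n : ℕ} [NeZero n] (x y : Site d n) :
    toTorus (x - y) = toTorus x - toTorus y := by
  funext i; simp [toTorus]

theorem exists_norm_sub_toAddCircle_le (n : ℕ) [NeZero n] (u : UnitAddCircle) :
    ∃ k : ZMod n, ‖u - ZMod.toAddCircle k‖ ≤ (n : ℝ)⁻¹ := by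
  obtain ⟨x, rfl⟩ := QuotientAddGroup.mk_surjective u
  have hn : (0 : ℝ) < n := by exact_mod_cast NeZero.pos n
  refine ⟨(⌊x * n⌋ : ℤ), ?_⟩
  rw [ZMod.toAddCircle_intCast]
  change ‖((x : ℝ) : UnitAddCircle) - (((⌊x * n⌋ : ℝ) / n : ℝ) : UnitAddCircle)‖ ≤ _
  rw [← AddCircle.coe_sub]
  have h1 := Int.floor_le (x * n)
  have h2 := Int.lt_floor_add_one (x * n)
  have h3 : x - (⌊x * n⌋ : ℝ) / n = (x * n - ⌊x * n⌋) * (n : ℝ)⁻¹ := by field_simp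
  refine (UnitAddCircle.norm_eq (x := _)).le.trans ?_
  refine (round_le _ 0).trans ?_
  rw [h3, Int.cast_zero, sub_zero, abs_of_nonneg (by nlinarith [inv_pos.2 hn])]
  nlinarith [inv_pos.2 hn]

theorem exists_dist_toTorus_le {d : ℕ} (n : ℕ) [NeZero n] (r : Torus d) :
    ∃ x : Site d n, dist r (toTorus x) ≤ (n : ℝ)⁻¹ := by
  choose f hf using exists_norm_sub_toAddCircle_le n
  refine ⟨fun i => f (r i), (dist_pi_le_iff (by positivity)).2 fun i => ?_⟩
  rw [dist_eq_norm]
  exact hf (r i)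

theorem integrable_of_continuous {d : ℕ} {g : Torus d → ℝ} (hg : Continuous g) :
    Integrable g :=
  hg.integrable_of_hasCompactSupport (HasCompactSupport.of_compactSpace g)

theorem integral_siteMean_add {d : ℕ} (n : ℕ) [NeZero n] {g : Torus d → ℝ} (hg : Continuous g) :
    ∫ r, siteMean (fun x : Site d n => g (r + toTorus x)) = ∫ r, g r := by
  simp only [siteMean]
  rw [integral_const_mul, integral_finsetSum]
  · simp only [integral_add_right_eq_self g]
    exact siteMean_const (d := d) (n := n) _
  · intro x _
    exact integrable_of_continuous (by fun_prop)

theorem tendsto_inv_odd : Tendsto (fun k : ℕ => ((2 * k + 1 : ℕ) : ℝ)⁻¹) atTop (𝓝 0) := by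
  refine tendsto_inv_atTop_zero.comp (tendsto_natCast_atTop_atTop.comp ?_)
  exact tendsto_atTop_mono (f := fun k => k) (fun k => by omega) tendsto_id

/-- By translation invariance, the lattice average shifted by $r$ integrates over $r$ to exactly
$\int g$. Each $r$ is within $1/n$ of a lattice point, and a shift by a lattice point only permutes
the sum; uniform continuity of $g$ does the rest. -/
theorem tendsto_siteMean {d : ℕ} {g : Torus d → ℝ} (hg : Continuous g) :
    Tendsto (fun k : ℕ => siteMean (fun x : Site d (2 * k + 1) => g (toTorus x))) atTop
      (𝓝 (∫ r, g r)) := by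
  rw [Metric.tendsto_nhds]
  intro ε hε
  obtain ⟨η, hη, h⟩ := Metric.uniformContinuous_iff.1
    (CompactSpace.uniformContinuous_of_continuous hg) (ε / 2) (by positivity)
  filter_upwards [tendsto_inv_odd.eventually_lt_const hη] with k hk
  set n := 2 * k + 1
  have key : ∀ r : Torus d, |siteMean (fun x : Site d n => g (toTorus x)) -
      siteMean (fun x : Site d n => g (r + toTorus x))| ≤ ε / 2 := by
    intro r
    obtain ⟨y, hy⟩ := exists_dist_toTorus_le n r
    have h1 : siteMean (fun x : Site d n => g (toTorus x)) =
        siteMean (fun x : Site d n => g (toTorus (y + x))) := by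
      simp only [siteMean]
      rw [← Equiv.sum_comp (Equiv.addLeft y)]
      rfl
    rw [h1]
    refine abs_siteMean_sub_le fun x => ?_
    have := h (a := toTorus (y + x)) (b := r + toTorus x) (by
      rw [toTorus_add, dist_add_right, dist_comm]
      exact hy.trans_lt hk)
    exact this.le
  have hint : Integrable (fun r : Torus d => siteMean (fun x : Site d n => g (r + toTorus x))) :=
    integrable_of_continuous (by unfold siteMean; fun_prop)
  rw [dist_comm, Real.dist_eq, ← integral_siteMean_add n hg]
  have h2 : siteMean (fun x : Site d n => g (toTorus x)) =
      ∫ _ : Torus d, siteMean (fun x : Site d n => g (toTorus x)) := by simp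
  rw [h2, ← integral_sub hint (integrable_const _), ← Real.norm_eq_abs]
  refine (norm_integral_le_of_norm_le_const (C := ε / 2) (.of_forall fun r => ?_)).trans_lt ?_
  · rw [Real.norm_eq_abs, abs_sub_comm]; exact key r
  · simp; linarith

/-! ### Law of large numbers for the random field -/

theorem abs_spin {d n : ℕ} (σ : Config d n) (x : Site d n) : |spin σ x| = 1 := by
  rcases Int.units_eq_one_or (σ x) with h | h <;> simp [spin, h]

section LLN

variable {d : ℕ} {a p : Fin 2 → ℝ}

theorem le_one_of_add_eq_one (hp : ∀ i, 0 ≤ p i) (hp1 : p 0 + p 1 = 1) (i : Fin 2) :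
    p i ≤ 1 := by
  fin_cases i
  · have := hp 1; simp; linarith
  · have := hp 0; simp; linarith

open Classical in
/-- The centred indicator that the field takes the value `a_i`. -/
def centredIndicator (a p : Fin 2 → ℝ) (i : Fin 2) (u : ℝ) : ℝ :=
  (if u = a i then 1 else 0) - p i

theorem measurable_centredIndicator (i : Fin 2) : Measurable (centredIndicator a p i) := by
  unfold centredIndicator
  exact (Measurable.ite (measurableSet_singleton _) measurable_const measurable_const).sub_const _

theorem colour_sub (n : ℕ) (α : (Fin d → ℤ) → ℝ) (i : Fin 2) (x : Site d n) :
    colour n a α i x - p i = centredIndicator a p i (α fun j => (x j).valMinAbs) := rfl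

theorem integral_centredIndicator (ha : a 0 ≠ a 1) (hp : ∀ i, 0 ≤ p i) (hp1 : p 0 + p 1 = 1)
    (i : Fin 2) : ∫ u, centredIndicator a p i u ∂(siteLaw a p) = 0 := by
  have hi (j : Fin 2) : Integrable (centredIndicator a p i)
      (ENNReal.ofReal (p j) • Measure.dirac (a j)) :=
    (integrable_dirac (by simp)).smul_measure (by simp)
  rw [siteLaw, integral_finsetSum_measure fun j _ => hi j]
  simp only [integral_smul_measure, integral_dirac, ENNReal.toReal_ofReal (hp _), smul_eq_mul,
    Fin.sum_univ_two, centredIndicator]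
  fin_cases i
  · simp [ha.symm]; linear_combination (-p 0) * hp1
  · simp [ha]; linear_combination (-p 1) * hp1

/-- Hoeffding's inequality: the sum has $n^d$ independent centred terms, each sub-Gaussian with
parameter $C^2$. The weights must be deterministic for independence to hold. -/
theorem measure_abs_siteMean_ge_le (ha : a 0 ≠ a 1) (hp : ∀ i, 0 ≤ p i) (hp1 : p 0 + p 1 = 1)
    (n : ℕ) [NeZero n] (i : Fin 2) {C : ℝ} (hC : 0 < C) {c : Site d n → ℝ} (hc : ∀ x, |c x| ≤ C)
    {ε : ℝ} (hε : 0 < ε) :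
    disorderLaw d a p {α | ε ≤ |siteMean fun x => c x * (colour n a α i x - p i)|} ≤
      ENNReal.ofReal (2 * Real.exp (-(ε ^ 2 / (2 * C ^ 2)) * (n : ℝ) ^ d)) := by
  have := isProbabilityMeasure_siteLaw a p hp hp1
  have := isProbabilityMeasure_disorderLaw d a p hp hp1
  have hN : (0 : ℝ) < (n : ℝ) ^ d := by have := NeZero.pos n; positivity
  have hp_le := le_one_of_add_eq_one hp hp1
  have h0 (j : Fin d → ℤ) : HasSubgaussianMGF (fun α : (Fin d → ℤ) → ℝ =>
      centredIndicator a p i (α j)) 1 (disorderLaw d a p) := by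
    have hmp : MeasurePreserving (Function.eval j) (disorderLaw d a p) (siteLaw a p) :=
      measurePreserving_eval_infinitePi _ _
    have h1 : HasSubgaussianMGF (fun u => centredIndicator a p i u) 1 (siteLaw a p) := by
      -- The parameter $1$ is the squared half-length of $[-1,1]$.
      have := hasSubgaussianMGF_of_mem_Icc_of_integral_eq_zero (μ := siteLaw a p) (a := -1) (b := 1)
        (X := centredIndicator a p i) (measurable_centredIndicator i).aemeasurable
        (.of_forall fun u => by
          have := hp i; have := hp_le i
          unfold centredIndicator
          split_ifs <;> constructor <;> linarith)
        (integral_centredIndicator ha hp hp1 i)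
      convert this using 1
      rw [← NNReal.coe_inj]; simp; norm_num
    rw [← hmp.map_eq] at h1
    exact HasSubgaussianMGF.of_map hmp.measurable.aemeasurable h1
  have hind : iIndepFun (fun (x : Site d n) (α : (Fin d → ℤ) → ℝ) =>
      c x * centredIndicator a p i (α fun j => (x j).valMinAbs)) (disorderLaw d a p) := by
    have h1 : iIndepFun (fun (j : Fin d → ℤ) (α : (Fin d → ℤ) → ℝ) =>
        centredIndicator a p i (α j)) (disorderLaw d a p) :=
      iIndepFun_infinitePi (X := fun _ u => centredIndicator a p i u)
        fun _ => measurable_centredIndicator i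
    -- Distinct sites of the discrete torus read distinct coordinates of the field on $\mathbb Z^d$.
    have h2 := h1.precomp (g := fun (x : Site d n) (j : Fin d) => (x j).valMinAbs)
      fun x y hxy => funext fun j => ZMod.injective_valMinAbs (congrFun hxy j)
    exact h2.comp (fun x u => c x * u) fun x => by fun_prop
  have hsub (x : Site d n) : HasSubgaussianMGF (fun α : (Fin d → ℤ) → ℝ =>
      c x * centredIndicator a p i (α fun j => (x j).valMinAbs))
      (C ^ 2).toNNReal (disorderLaw d a p) := by
    have h1 := (h0 fun j => (x j).valMinAbs).const_mul (c x)
    refine ⟨h1.1, fun t => (h1.2 t).trans ?_⟩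
    have : c x ^ 2 ≤ C ^ 2 := sq_le_sq' (abs_le.1 (hc x)).1 (abs_le.1 (hc x)).2
    refine Real.exp_le_exp.2 ?_
    rw [Real.coe_toNNReal _ (sq_nonneg C)]
    change c x ^ 2 * 1 * t ^ 2 / 2 ≤ C ^ 2 * t ^ 2 / 2
    rw [mul_one]
    gcongr
  have hsum := HasSubgaussianMGF.sum_of_iIndepFun hind (s := Finset.univ) fun x _ => hsub x
  have hexp : -(ε * (n : ℝ) ^ d) ^ 2 /
      (2 * ((∑ _x : Site d n, (C ^ 2).toNNReal : NNReal) : ℝ)) =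
      -(ε ^ 2 / (2 * C ^ 2)) * (n : ℝ) ^ d := by
    rw [Finset.sum_const, NNReal.coe_nsmul, Finset.card_univ, nsmul_eq_mul, card_site]
    rw [Real.coe_toNNReal _ (sq_nonneg C)]
    field_simp
  have hpos := hsum.measure_ge_le (ε := ε * (n : ℝ) ^ d) (by positivity)
  have hneg := hsum.neg.measure_ge_le (ε := ε * (n : ℝ) ^ d) (by positivity)
  rw [hexp] at hpos hneg
  have hset : {α | ε ≤ |siteMean fun x : Site d n => c x * (colour n a α i x - p i)|} ⊆
      {α | ε * (n : ℝ) ^ d ≤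
        ∑ x : Site d n, c x * centredIndicator a p i (α fun j => (x j).valMinAbs)} ∪
      {α | ε * (n : ℝ) ^ d ≤
        (-fun α : (Fin d → ℤ) → ℝ =>
          ∑ x : Site d n, c x * centredIndicator a p i (α fun j => (x j).valMinAbs)) α} := by
    intro α hα
    simp only [Set.mem_ofPred_eq, siteMean, colour_sub, abs_mul, abs_pow, abs_inv] at hα
    rw [abs_of_nonneg (Nat.cast_nonneg n), inv_pow, ← div_eq_inv_mul, le_div_iff₀ hN] at hα
    rcases le_abs.1 hα with h | h
    · exact Or.inl h
    · exact Or.inr h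
  have := measureReal_mono hset (μ := disorderLaw d a p)
  rw [← ofReal_measureReal]
  refine ENNReal.ofReal_le_ofReal (this.trans ((measureReal_union_le _ _).trans ?_))
  linarith

/-- Borel–Cantelli: as $d\ge1$, $(2k+1)^d\ge k$, so the Hoeffding bounds are dominated by a
geometric series. -/
theorem ae_tendsto_siteMean_centred (hd : 1 ≤ d) (ha : a 0 ≠ a 1) (hp : ∀ i, 0 ≤ p i)
    (hp1 : p 0 + p 1 = 1) (i : Fin 2) {C : ℝ} (c : (k : ℕ) → Site d (2 * k + 1) → ℝ)
    (hc : ∀ k x, |c k x| ≤ C) :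
    ∀ᵐ α ∂(disorderLaw d a p), Tendsto
      (fun k => siteMean fun x => c k x * (colour (2 * k + 1) a α i x - p i)) atTop (𝓝 0) := by
  wlog hC : 0 < C generalizing C
  · exact this (C := max C 1) (fun k x => (hc k x).trans (le_max_left _ _)) (by positivity)
  have hsum (ε : ℝ) (hε : 0 < ε) : ∀ᵐ α ∂(disorderLaw d a p), ∀ᶠ k in atTop,
      |siteMean fun x => c k x * (colour (2 * k + 1) a α i x - p i)| < ε := by
    set b := ε ^ 2 / (2 * C ^ 2)
    have hb : 0 < b := by positivity
    have hs : Summable fun k : ℕ => 2 * Real.exp (-b * k) :=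
      (Real.summable_exp_nat_mul_iff.2 (neg_neg_of_pos hb) |>.congr fun k => by
        rw [mul_comm]).mul_left 2
    have := ae_eventually_notMem (μ := disorderLaw d a p)
      (s := fun k : ℕ => {α | ε ≤ |siteMean fun x => c k x * (colour (2 * k + 1) a α i x - p i)|})
      (ne_top_of_le_ne_top hs.tsum_ofReal_ne_top (ENNReal.tsum_le_tsum fun k => by
        refine (measure_abs_siteMean_ge_le ha hp hp1 (2 * k + 1) i hC (hc k) hε).trans ?_
        refine ENNReal.ofReal_le_ofReal ?_
        refine mul_le_mul_of_nonneg_left (Real.exp_le_exp.2 ?_) zero_le_two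
        refine mul_le_mul_of_nonpos_left ?_ (neg_nonpos.2 hb.le)
        have h1 : (k : ℝ) ≤ ((2 * k + 1 : ℕ) : ℝ) := by exact_mod_cast (by omega)
        exact h1.trans (le_self_pow₀ (by exact_mod_cast (by omega)) (by omega))))
    filter_upwards [this] with α hα
    filter_upwards [hα] with k hk
    simpa using hk
  have hall := ae_all_iff.2 fun N : ℕ => hsum (1 / ((N : ℝ) + 1)) Nat.one_div_pos_of_nat
  filter_upwards [hall] with α hα
  rw [Metric.tendsto_nhds]
  intro ε hε
  obtain ⟨N, hN⟩ := exists_nat_one_div_lt hε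
  filter_upwards [hα N] with k hk
  rw [Real.dist_eq, sub_zero]
  exact hk.trans hN

/-- A countable dense family in $C(\Lambda)$ gives one null set valid for all $g$: the average is
$1$-Lipschitz in $g$ for the uniform norm. The weight $s$ is later taken to be $1$ or the initial
spins. -/
theorem ae_forall_tendsto_siteMean_centred (hd : 1 ≤ d) (ha : a 0 ≠ a 1) (hp : ∀ i, 0 ≤ p i)
    (hp1 : p 0 + p 1 = 1) (s : (k : ℕ) → Site d (2 * k + 1) → ℝ) (hs : ∀ k x, |s k x| ≤ 1) :
    ∀ᵐ α ∂(disorderLaw d a p), ∀ (i : Fin 2) (g : Torus d → ℝ), Continuous g → Tendsto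
      (fun k => siteMean fun x => g (toTorus x) * s k x * (colour (2 * k + 1) a α i x - p i))
      atTop (𝓝 0) := by
  rw [ae_all_iff]
  intro i
  have hp_le := le_one_of_add_eq_one hp hp1 i
  have h0 : ∀ᵐ α ∂(disorderLaw d a p), ∀ N : ℕ, Tendsto
      (fun k => siteMean fun x => TopologicalSpace.denseSeq C(Torus d, ℝ) N (toTorus x) * s k x *
        (colour (2 * k + 1) a α i x - p i)) atTop (𝓝 0) := by
    refine ae_all_iff.2 fun N => ?_
    set f := TopologicalSpace.denseSeq C(Torus d, ℝ) N
    refine ae_tendsto_siteMean_centred hd ha hp hp1 i (C := ‖f‖) _ fun k x => ?_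
    rw [abs_mul, ← mul_one ‖f‖]
    exact mul_le_mul (f.norm_coe_le_norm _) (hs k x) (abs_nonneg _) (norm_nonneg _)
  filter_upwards [h0] with α hα g hg
  rw [Metric.tendsto_nhds]
  intro ε hε
  obtain ⟨N, hN⟩ := (TopologicalSpace.denseRange_denseSeq C(Torus d, ℝ)).exists_dist_lt
    (⟨g, hg⟩ : C(Torus d, ℝ)) (half_pos hε)
  filter_upwards [Metric.tendsto_nhds.1 (hα N) (ε / 2) (half_pos hε)] with k hk
  rw [Real.dist_eq, sub_zero] at hk ⊢
  have : |(siteMean fun x => g (toTorus x) * s k x * (colour (2 * k + 1) a α i x - p i)) -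
      siteMean fun x => TopologicalSpace.denseSeq C(Torus d, ℝ) N (toTorus x) * s k x *
        (colour (2 * k + 1) a α i x - p i)| ≤ ε / 2 := by
    refine abs_siteMean_sub_le fun x => ?_
    rw [← sub_mul, ← sub_mul, abs_mul, abs_mul]
    have h1 : |g (toTorus x) - TopologicalSpace.denseSeq C(Torus d, ℝ) N (toTorus x)| ≤ ε / 2 :=
      (ContinuousMap.dist_apply_le_dist (f := ⟨g, hg⟩)
        (g := TopologicalSpace.denseSeq C(Torus d, ℝ) N) (toTorus x)).trans hN.le
    have h2 : |colour (2 * k + 1) a α i x - p i| ≤ 1 := by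
      have := hp i
      unfold colour
      rw [abs_le]
      split_ifs <;> constructor <;> linarith
    calc _ ≤ ε / 2 * 1 * 1 := by gcongr; exact hs k x
      _ = ε / 2 := by ring
  rw [abs_lt] at hk ⊢
  rw [abs_le] at this
  constructor <;> linarith [this.1, this.2]

end LLN

/-! ### Flip rates and the generator on linear functionals -/

section Rates

variable {d n : ℕ} [NeZero n] {J : Torus d → ℝ} {θ : ℝ} {α : (Fin d → ℤ) → ℝ}

/-- The field `∑_{y ≠ x} J_γ(x,y) σ(y)` felt by the spin at `x`. -/
def localField (J : Torus d → ℝ) (σ : Config d n) (x : Site d n) : ℝ :=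
  ∑ y, kac J x y * spin σ y - kac J x x * spin σ x

/-- The convolution of `J` with the empirical measure of `σ`. -/
def kacField (J : Torus d → ℝ) (σ : Config d n) (r : Torus d) : ℝ :=
  siteMean fun y => J (r - toTorus y) * spin σ y

omit [NeZero n] in
theorem spin_mul_self (σ : Config d n) (x : Site d n) : spin σ x * spin σ x = 1 := by
  rw [← abs_mul_abs_self, abs_spin, one_mul]

omit [NeZero n] in
theorem spin_flip (σ : Config d n) (x y : Site d n) :
    spin (flip σ x) y = spin σ y - 2 * spin σ x * if y = x then 1 else 0 := by
  by_cases h : y = x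
  · subst h; simp [spin, flip]; ring
  · simp [spin, flip, h]

/-- Row $x$ and column $x$ of the quadratic form change by the same amount because $J$ is even. The
self-interaction drops out because the square of a spin does not change under the flip. -/
theorem energy_flip_sub (hJ : ∀ r, J (-r) = J r) (σ : Config d n) (x : Site d n) :
    energy J θ α (flip σ x) - energy J θ α σ =
      2 * (spin σ x * (localField J σ x + θ * latticeField n α x)) := by
  have hsymm (y z : Site d n) : kac J y z = kac J z y := by
    unfold kac
    rw [← hJ, toTorus_sub, toTorus_sub, neg_sub]
  have hq : ∑ y, ∑ z, kac J y z * spin (flip σ x) y * spin (flip σ x) z =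
      ∑ y, ∑ z, kac J y z * spin σ y * spin σ z - 4 * spin σ x * localField J σ x := by
    -- The last term corrects the diagonal entry $(x,x)$, which the row and the column corrections
    -- both subtract.
    have h1 (y z : Site d n) : kac J y z * spin (flip σ x) y * spin (flip σ x) z =
        kac J y z * spin σ y * spin σ z
        - (if z = x then 2 * spin σ x * (kac J x y * spin σ y) else 0)
        - (if y = x then 2 * spin σ x * (kac J x z * spin σ z) else 0)
        + (if z = x then (if y = x then 4 * (kac J x x * (spin σ x * spin σ x)) else 0)
          else 0) := by
      rw [spin_flip, spin_flip]
      by_cases hy : y = x <;> by_cases hz : z = x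
      · subst hy; subst hz; simp; ring
      · subst hy; simp [hz]; ring
      · subst hz; simp [hy]; rw [hsymm y z]; ring
      · simp [hy, hz]
    simp only [h1, Finset.sum_add_distrib, Finset.sum_sub_distrib, Finset.sum_ite_eq',
      Finset.mem_univ, if_true]
    rw [Finset.sum_comm (f := fun y z => if y = x then 2 * spin σ x * (kac J x z * spin σ z) else 0)]
    simp only [Finset.sum_ite_eq', Finset.mem_univ, if_true, ← Finset.mul_sum, localField]
    ring
  have hl : ∑ y, latticeField n α y * spin (flip σ x) y =
      ∑ y, latticeField n α y * spin σ y - 2 * spin σ x * latticeField n α x := by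
    simp only [spin_flip, mul_sub, Finset.sum_sub_distrib]
    simp
    ring
  unfold energy
  rw [hq, hl]
  ring

theorem exp_neg_div_two_cosh (u : ℝ) :
    Real.exp (-u) / (2 * Real.cosh u) = (1 - Real.tanh u) / 2 := by
  have := Real.cosh_pos u
  rw [Real.tanh_eq_sinh_div_cosh, Real.exp_neg, ← Real.exp_neg, ← Real.cosh_sub_sinh]
  field_simp

/-- Oddness of $\tanh$ takes the spin out of the argument. Multiplied by the jump $-2\sigma(x)$, the
rate then gives $-\sigma(x)+\tanh(\cdot)$, the form of the limiting equation. -/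
theorem flipRate_eq (hJ : ∀ r, J (-r) = J r) (σ : Config d n) (x : Site d n) :
    flipRate J θ α x σ =
      (1 - spin σ x * Real.tanh (localField J σ x + θ * latticeField n α x)) / 2 := by
  have h1 : -(1 / 2) * (energy J θ α (flip σ x) - energy J θ α σ) =
      -((1 / 2) * (energy J θ α (flip σ x) - energy J θ α σ)) := by ring
  rw [flipRate, h1, exp_neg_div_two_cosh, energy_flip_sub hJ]
  have h2 (v : ℝ) : 1 / 2 * (2 * v) = v := by ring
  rw [h2]
  rcases Int.units_eq_one_or (σ x) with h | h
  · simp [spin, h]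
  · have : spin σ x = -1 := by simp [spin, h]
    rw [this, neg_one_mul, neg_one_mul, Real.tanh_neg]

theorem abs_tanh_le_one (u : ℝ) : |Real.tanh u| ≤ 1 :=
  (Real.abs_tanh_lt_one u).le

theorem flipRate_le_one (hJ : ∀ r, J (-r) = J r) (σ : Config d n) (x : Site d n) :
    flipRate J θ α x σ ≤ 1 := by
  rw [flipRate_eq hJ]
  have h : |spin σ x * Real.tanh (localField J σ x + θ * latticeField n α x)| ≤ 1 := by
    rw [abs_mul, abs_spin, one_mul]; exact abs_tanh_le_one _
  linarith [(abs_le.1 h).1]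

theorem generator_siteMean (hJ : ∀ r, J (-r) = J r) (c : Site d n → ℝ) (σ : Config d n) :
    generator J θ α (fun η => siteMean fun x => c x * spin η x) σ =
      - siteMean (fun x => c x * spin σ x) +
        siteMean (fun x => c x * Real.tanh (localField J σ x + θ * latticeField n α x)) := by
  have h1 (x : Site d n) : siteMean (fun y => c y * spin (flip σ x) y) -
      siteMean (fun y => c y * spin σ y) = ((n : ℝ)⁻¹) ^ d * (c x * (-2 * spin σ x)) := by
    simp only [siteMean, spin_flip, mul_sub, Finset.sum_sub_distrib]
    simp
  simp only [generator, h1, flipRate_eq hJ]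
  rw [neg_add_eq_sub, ← siteMean_sub, siteMean, Finset.mul_sum]
  refine Finset.sum_congr rfl fun x _ => ?_
  linear_combination (((n : ℝ)⁻¹) ^ d * c x *
    Real.tanh (localField J σ x + θ * latticeField n α x)) * spin_mul_self σ x

theorem generator_sq_sub (f : Config d n → ℝ) (σ : Config d n) :
    generator J θ α (fun η => f η ^ 2) σ - 2 * f σ * generator J θ α f σ =
      ∑ x, flipRate J θ α x σ * (f (flip σ x) - f σ) ^ 2 := by
  simp only [generator, Finset.mul_sum, ← Finset.sum_sub_distrib]
  refine Finset.sum_congr rfl fun x _ => ?_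
  ring

/-- There are $n^d$ sites with rates at most $1$. For averages the jumps are $O(n^{-d})$, so the
bound becomes $O(n^{-d})$. -/
theorem carre_du_champ_le (hJ : ∀ r, J (-r) = J r) {f : Config d n → ℝ} {b : ℝ}
    (hf : ∀ σ x, |f (flip σ x) - f σ| ≤ b) (σ : Config d n) :
    generator J θ α (fun η => f η ^ 2) σ - 2 * f σ * generator J θ α f σ ≤ (n : ℝ) ^ d * b ^ 2 := by
  rw [generator_sq_sub, ← card_site (d := d) (n := n), ← nsmul_eq_mul, ← Finset.card_univ,
    ← Finset.sum_const]
  refine Finset.sum_le_sum fun x _ => ?_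
  rw [← one_mul (b ^ 2)]
  exact mul_le_mul (flipRate_le_one hJ σ x)
    (sq_le_sq' (abs_le.1 (hf σ x)).1 (abs_le.1 (hf σ x)).2) (sq_nonneg _) zero_le_one

theorem abs_siteMean_flip_sub_le {c : Site d n → ℝ} {C : ℝ} (hc : ∀ x, |c x| ≤ C)
    (σ : Config d n) (x : Site d n) :
    |siteMean (fun y => c y * spin (flip σ x) y) - siteMean (fun y => c y * spin σ y)| ≤
      ((n : ℝ)⁻¹) ^ d * (2 * C) := by
  have h1 : siteMean (fun y => c y * spin (flip σ x) y) -
      siteMean (fun y => c y * spin σ y) = ((n : ℝ)⁻¹) ^ d * (c x * (-2 * spin σ x)) := by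
    simp only [siteMean, spin_flip, mul_sub, Finset.sum_sub_distrib]
    simp
  rw [h1, abs_mul, abs_mul, abs_mul, abs_spin, abs_of_nonneg (a := ((n : ℝ)⁻¹) ^ d) (by positivity)]
  have := hc x
  refine mul_le_mul_of_nonneg_left ?_ (by positivity)
  rw [abs_neg, abs_two, mul_one]; linarith

theorem abs_localField_sub_kacField_le (σ : Config d n) (x : Site d n) :
    |localField J σ x - kacField J σ (toTorus x)| ≤ ((n : ℝ)⁻¹) ^ d * |J 0| := by
  have h0 : toTorus (0 : Site d n) = 0 := funext fun i => by simp [toTorus]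
  have h : localField J σ x - kacField J σ (toTorus x) = -(((n : ℝ)⁻¹) ^ d * J 0 * spin σ x) := by
    simp only [localField, kacField, siteMean, kac, Finset.mul_sum, mul_assoc,
      ← toTorus_sub, sub_self, sub_sub_cancel_left, h0]
  rw [h, abs_neg, abs_mul, abs_mul, abs_spin, mul_one, abs_of_nonneg (a := ((n : ℝ)⁻¹) ^ d)
    (by positivity)]

end Rates

theorem abs_tanh_sub_tanh_le (u v : ℝ) : |Real.tanh u - Real.tanh v| ≤ |u - v| := by
  have hd (x : ℝ) : HasDerivAt Real.tanh (1 / Real.cosh x ^ 2) x := by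
    have h := (Real.hasDerivAt_sinh x).div (Real.hasDerivAt_cosh x) (Real.cosh_pos x).ne'
    have h1 : Real.tanh = Real.sinh / Real.cosh := funext Real.tanh_eq_sinh_div_cosh
    rw [h1]
    refine h.congr_deriv ?_
    rw [← pow_two, ← pow_two, Real.cosh_sq_sub_sinh_sq]
  have := Convex.norm_image_sub_le_of_norm_hasDerivWithin_le (C := 1) (s := Set.univ) (x := v)
    (y := u) (fun x _ => (hd x).hasDerivWithinAt) (fun x _ => by
      have := Real.one_le_cosh x
      rw [Real.norm_eq_abs, abs_of_nonneg (by positivity)]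
      exact div_le_one_of_le₀ (one_le_pow₀ this) (by positivity)) convex_univ trivial trivial
  simpa using this

theorem continuous_tanh : Continuous Real.tanh :=
  (LipschitzWith.of_dist_le_mul (K := 1) fun u v => by
    simpa [Real.dist_eq] using abs_tanh_sub_tanh_le u v).continuous

/-! ### Dyadic times -/

section DyadicTime

variable {T : ℝ}

/-- The `j`-th dyadic time of level `N`, stopped at `T`. -/
def dyadicTime (hT : 0 < T) (N j : ℕ) : Time T := Set.projIcc 0 T hT.le (j * T / 2 ^ N)

/-- The first dyadic time of level `N` after `s`. -/
def dyadicIndex (T : ℝ) (N : ℕ) (s : Time T) : ℕ := ⌊(s : ℝ) * 2 ^ N / T⌋₊ + 1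

theorem dyadicTime_mono (hT : 0 < T) (N : ℕ) : Monotone (dyadicTime hT N) := fun i j h =>
  Set.monotone_projIcc hT.le (by gcongr)

theorem dyadicTime_eq_last (hT : 0 < T) {N j : ℕ} (h : 2 ^ N ≤ j) :
    dyadicTime hT N j = ⟨T, Set.right_mem_Icc.2 hT.le⟩ := by
  refine Set.projIcc_of_right_le hT.le ?_
  rw [le_div_iff₀ (by positivity), mul_comm]
  gcongr
  exact_mod_cast h

theorem dyadicTime_succ (hT : 0 < T) (N j : ℕ) :
    dyadicTime hT (N + 1) (2 * j) = dyadicTime hT N j := by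
  unfold dyadicTime
  congr 1
  push_cast
  rw [pow_succ]
  field_simp

theorem lt_dyadicIndex (hT : 0 < T) (N : ℕ) (s : Time T) :
    (s : ℝ) < (dyadicIndex T N s : ℝ) * T / 2 ^ N := by
  rw [lt_div_iff₀ (by positivity), ← div_lt_iff₀ hT]
  unfold dyadicIndex
  push_cast
  exact Nat.lt_floor_add_one _

theorem dyadicIndex_le (hT : 0 < T) (N : ℕ) (s : Time T) :
    (dyadicIndex T N s : ℝ) * T / 2 ^ N ≤ s + T / 2 ^ N := by
  have h := Nat.floor_le (a := (s : ℝ) * 2 ^ N / T)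
    (div_nonneg (mul_nonneg s.2.1 (by positivity)) hT.le)
  rw [le_div_iff₀ hT] at h
  unfold dyadicIndex
  push_cast
  rw [div_le_iff₀ (by positivity), add_mul, add_mul, div_mul_cancel₀ _ (by positivity)]
  linarith

/-- The `+ 1` in `dyadicIndex` makes the approximation strictly later than $s$, so it lies in the
punctured right neighbourhood where right continuity applies. -/
theorem tendsto_dyadicTime (hT : 0 < T) {s : Time T} (hs : (s : ℝ) < T) :
    Tendsto (fun N => dyadicTime hT N (dyadicIndex T N s)) atTop (𝓝[>] s) := by
  refine tendsto_nhdsWithin_iff.2 ⟨?_, .of_forall fun N => ?_⟩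
  · have h1 : Tendsto (fun N : ℕ => (dyadicIndex T N s : ℝ) * T / 2 ^ N) atTop (𝓝 (s : ℝ)) := by
      refine tendsto_of_tendsto_of_tendsto_of_le_of_le tendsto_const_nhds ?_
        (fun N => (lt_dyadicIndex hT N s).le) (fun N => dyadicIndex_le hT N s)
      have : Tendsto (fun N : ℕ => T * (1 / 2 : ℝ) ^ N) atTop (𝓝 (T * 0)) :=
        (tendsto_pow_atTop_nhds_zero_of_lt_one (by norm_num) (by norm_num)).const_mul T
      have h2 := this.const_add (s : ℝ)
      simp only [mul_zero, add_zero] at h2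
      refine h2.congr fun N => ?_
      simp [div_eq_mul_inv]
    have h2 := (continuous_projIcc (h := hT.le)).continuousAt.tendsto.comp h1
    rwa [Set.projIcc_val] at h2
  · have h := lt_dyadicIndex hT N s
    rw [Set.mem_Ioi, ← Subtype.coe_lt_coe]
    unfold dyadicTime
    rw [Set.coe_projIcc, min_def]
    split_ifs with h3
    · exact lt_max_of_lt_right hs
    · exact lt_max_of_lt_right h

theorem eventually_eq_dyadicTime {S : Type} (hT : 0 < T) (w : PathSpace T S) (s : Time T) :
    ∀ᶠ N in atTop, w.1 (dyadicTime hT N (dyadicIndex T N s)) = w.1 s := by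
  by_cases hs : (s : ℝ) < T
  · exact (tendsto_dyadicTime hT hs).eventually (w.2 s).1
  · have hs' : s = ⟨T, Set.right_mem_Icc.2 hT.le⟩ := Subtype.ext (le_antisymm s.2.2 (not_lt.1 hs))
    refine .of_forall fun N => ?_
    rw [hs', dyadicTime]
    rw [Set.projIcc_of_right_le hT.le]
    exact (lt_dyadicIndex hT N ⟨T, Set.right_mem_Icc.2 hT.le⟩).le

end DyadicTime

/-! ### The maximal inequality for right continuous martingales -/

section Maximal

variable {T : ℝ} {Ω : Type*} {mΩ : MeasurableSpace Ω} {μ : Measure Ω}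

/-- Doob's maximal inequality for the discrete submartingale $|M|=M\vee(-M)$ sampled on the grid. -/
theorem measure_exists_dyadic_le [IsFiniteMeasure μ] (hT : 0 < T) {ℱ : Filtration (Time T) mΩ}
    {M : Time T → Ω → ℝ} (hM : Martingale M ℱ μ) {ε : ℝ} (hε : 0 < ε) (N : ℕ) :
    μ {ω | ∃ j ≤ 2 ^ N, ε ≤ |M (dyadicTime hT N j) ω|} ≤
      ENNReal.ofReal ((∫ ω, |M ⟨T, Set.right_mem_Icc.2 hT.le⟩ ω| ∂μ) / ε) := by
  let 𝒢 : Filtration ℕ mΩ :=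
    ⟨fun j => ℱ (dyadicTime hT N j), fun i j h => ℱ.mono (dyadicTime_mono hT N h), fun j => ℱ.le _⟩
  have hX : Martingale (fun j => M (dyadicTime hT N j)) 𝒢 μ :=
    ⟨fun j => hM.1 _, fun i j h => hM.2 _ _ (dyadicTime_mono hT N h)⟩
  have hsub : Submartingale (fun j ω => |M (dyadicTime hT N j) ω|) 𝒢 μ :=
    hX.submartingale.sup hX.neg.submartingale
  have hmax := maximal_ineq hsub (fun j ω => abs_nonneg _) (ε := ε.toNNReal) (2 ^ N)
  rw [Real.coe_toNNReal _ hε.le] at hmax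
  have hlast : ∫ ω in {ω | ε ≤ (Finset.range (2 ^ N + 1)).sup' Finset.nonempty_range_add_one
      fun k => |M (dyadicTime hT N k) ω|}, |M (dyadicTime hT N (2 ^ N)) ω| ∂μ ≤
      ∫ ω, |M ⟨T, Set.right_mem_Icc.2 hT.le⟩ ω| ∂μ := by
    rw [dyadicTime_eq_last hT le_rfl]
    exact setIntegral_le_integral (hM.integrable _).abs (.of_forall fun ω => abs_nonneg _)
  have hset : {ω | ∃ j ≤ 2 ^ N, ε ≤ |M (dyadicTime hT N j) ω|} ⊆
      {ω | ε ≤ (Finset.range (2 ^ N + 1)).sup' Finset.nonempty_range_add_one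
        fun k => |M (dyadicTime hT N k) ω|} := by
    rintro ω ⟨j, hj, h⟩
    exact h.trans (Finset.le_sup' (fun k => |M (dyadicTime hT N k) ω|)
      (Finset.mem_range.2 (Nat.lt_succ_of_le hj)))
  refine (measure_mono hset).trans ?_
  rw [ENNReal.ofReal_div_of_pos hε, ENNReal.le_div_iff_mul_le (Or.inl (by simpa using hε))
    (Or.inl ENNReal.ofReal_ne_top), mul_comm]
  exact hmax.trans (ENNReal.ofReal_le_ofReal hlast)

/-- By right continuity, a strict exceedance persists at a slightly later dyadic time. The dyadic
events increase with the level, so the measure of their union is the supremum of their measures. -/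
theorem measure_exists_lt_abs_le [IsFiniteMeasure μ] (hT : 0 < T) {ℱ : Filtration (Time T) mΩ}
    {M : Time T → Ω → ℝ} (hM : Martingale M ℱ μ)
    (hcont : ∀ ω (t : Time T), ContinuousWithinAt (fun s => M s ω) (Set.Ioi t) t)
    {ε : ℝ} (hε : 0 < ε) :
    μ {ω | ∃ t, ε < |M t ω|} ≤
      ENNReal.ofReal ((∫ ω, |M ⟨T, Set.right_mem_Icc.2 hT.le⟩ ω| ∂μ) / ε) := by
  have hsub : {ω | ∃ t, ε < |M t ω|} ⊆
      ⋃ N : ℕ, {ω | ∃ j ≤ 2 ^ N, ε ≤ |M (dyadicTime hT N j) ω|} := by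
    have hcap (N j : ℕ) : dyadicTime hT N (min j (2 ^ N)) = dyadicTime hT N j := by
      rcases le_total j (2 ^ N) with h | h
      · rw [min_eq_left h]
      · rw [min_eq_right h, dyadicTime_eq_last hT le_rfl, dyadicTime_eq_last hT h]
    rintro ω ⟨t, ht⟩
    refine Set.mem_iUnion.2 ?_
    by_cases hs : (t : ℝ) < T
    · have h1 := (hcont ω t).tendsto.abs.comp (tendsto_dyadicTime hT hs)
      obtain ⟨N, hN⟩ := (h1.eventually_const_lt ht).exists
      exact ⟨N, min (dyadicIndex T N t) (2 ^ N), min_le_right _ _, by rw [hcap]; exact hN.le⟩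
    · have hs' : t = ⟨T, Set.right_mem_Icc.2 hT.le⟩ :=
        Subtype.ext (le_antisymm t.2.2 (not_lt.1 hs))
      exact ⟨0, 2 ^ 0, le_rfl, by rw [dyadicTime_eq_last hT le_rfl, ← hs']; exact ht.le⟩
  have hmono : Monotone fun N : ℕ => {ω | ∃ j ≤ 2 ^ N, ε ≤ |M (dyadicTime hT N j) ω|} := by
    refine monotone_nat_of_le_succ fun N => ?_
    rintro ω ⟨j, hj, h⟩
    exact ⟨2 * j, by rw [pow_succ]; omega, by rwa [dyadicTime_succ]⟩
  refine (measure_mono hsub).trans ?_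
  rw [hmono.measure_iUnion]
  exact iSup_le fun N => measure_exists_dyadic_le hT hM hε N

end Maximal

/-! ### Measurability and integrals along paths -/

section Path

variable {T : ℝ} {S : Type}

/-- The path `w`, as a function of a real time (constant outside `[0,T]`). -/
def evalAt (hT : 0 < T) (w : PathSpace T S) (s : ℝ) : S := w.1 (Set.projIcc 0 T hT.le s)

/-- The integral `∫_0^t β(w_s) ds`. -/
def pathIntegral (hT : 0 < T) (β : S → ℝ) (t : ℝ) (w : PathSpace T S) : ℝ :=
  ∫ s in (0 : ℝ)..t, β (evalAt hT w s)

/-- The process `f(w_t) - f(w_0) - ∫_0^t β(w_s) ds`. -/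
def dynkin (hT : 0 < T) (f β : S → ℝ) (t : ℝ) (w : PathSpace T S) : ℝ :=
  f (evalAt hT w t) - f (w.1 (timeZero hT)) - pathIntegral hT β t w

theorem measurable_canonicalFiltration_eval (F : S → ℝ) {s t : Time T} (h : s ≤ t) :
    Measurable[canonicalFiltration T S t] fun w : PathSpace T S => F (w.1 s) := by
  have h1 : Measurable[MeasurableSpace.comap (fun w : PathSpace T S => w.1 s) ⊤]
      fun w : PathSpace T S => F (w.1 s) := by
    intro A _
    exact ⟨F ⁻¹' A, trivial, rfl⟩
  exact h1.mono (le_iSup (fun u : Set.Iic t =>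
    MeasurableSpace.comap (fun w : PathSpace T S => w.1 u.1) ⊤) ⟨s, h⟩) le_rfl

theorem measurable_eval (F : S → ℝ) (s : Time T) :
    Measurable fun w : PathSpace T S => F (w.1 s) :=
  (measurable_canonicalFiltration_eval F le_rfl).mono ((canonicalFiltration T S).le s) le_rfl

/-- A path is the pointwise limit of its values at the next dyadic time, and these depend measurably
on a countable index and on the path. -/
theorem measurable_uncurry_eval (hT : 0 < T) (F : S → ℝ) :
    Measurable fun q : Time T × PathSpace T S => F (q.2.1 q.1) := by
  refine measurable_of_tendsto_metrizable
    (f := fun N (q : Time T × PathSpace T S) =>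
      F (q.2.1 (dyadicTime hT N (dyadicIndex T N q.1)))) (fun N => ?_) ?_
  · have h1 : Measurable fun q : ℕ × PathSpace T S => F (q.2.1 (dyadicTime hT N q.1)) :=
      measurable_from_prod_countable_right fun j => measurable_eval F (dyadicTime hT N j)
    have h2 : Measurable (dyadicIndex T N) := by
      unfold dyadicIndex
      exact (Nat.measurable_floor.comp (by fun_prop)).add_const 1
    exact h1.comp ((h2.comp measurable_fst).prodMk measurable_snd)
  · rw [tendsto_pi_nhds]
    rintro ⟨s, w⟩
    refine tendsto_const_nhds.congr' ?_
    filter_upwards [eventually_eq_dyadicTime hT w s] with N hN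
    rw [hN]

theorem measurable_uncurry_evalAt (hT : 0 < T) (F : S → ℝ) :
    Measurable fun q : ℝ × PathSpace T S => F (evalAt hT q.2 q.1) :=
  (measurable_uncurry_eval hT F).comp
    (((continuous_projIcc (h := hT.le)).measurable.comp measurable_fst).prodMk measurable_snd)

theorem measurable_evalAt (hT : 0 < T) (F : S → ℝ) (w : PathSpace T S) :
    Measurable fun s => F (evalAt hT w s) :=
  (measurable_uncurry_evalAt hT F).comp (measurable_id.prodMk measurable_const)

theorem exists_abs_le [Finite S] (F : S → ℝ) : ∃ B, 0 ≤ B ∧ ∀ σ, |F σ| ≤ B := by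
  obtain ⟨B, hB⟩ := (Set.finite_range fun σ => |F σ|).bddAbove
  exact ⟨max B 0, le_max_right _ _, fun σ => (hB ⟨σ, rfl⟩).trans (le_max_left _ _)⟩

theorem intervalIntegrable_of_bounded {F : ℝ → ℝ} (hF : Measurable F) {B : ℝ}
    (hB : ∀ s, |F s| ≤ B) (u v : ℝ) : IntervalIntegrable F volume u v :=
  (intervalIntegrable_const (c := B)).mono_fun hF.aestronglyMeasurable
    (.of_forall fun s => by
      simpa using (hB s).trans (le_abs_self B))

theorem intervalIntegrable_evalAt [Finite S] (hT : 0 < T) (F : S → ℝ) (w : PathSpace T S)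
    (u v : ℝ) : IntervalIntegrable (fun s => F (evalAt hT w s)) volume u v := by
  obtain ⟨B, -, hB⟩ := exists_abs_le F
  exact intervalIntegrable_of_bounded (measurable_evalAt hT F w) (fun s => hB _) u v

theorem continuous_pathIntegral [Finite S] (hT : 0 < T) (β : S → ℝ) (w : PathSpace T S) :
    Continuous fun t => pathIntegral hT β t w :=
  intervalIntegral.continuous_primitive (fun u v => intervalIntegrable_evalAt hT β w u v) 0

theorem measurable_pathIntegral (hT : 0 < T) (β : S → ℝ) (t : ℝ) :
    Measurable (pathIntegral hT β t) := by
  have h := ((measurable_uncurry_evalAt hT β).comp measurable_swap).stronglyMeasurable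
  unfold pathIntegral
  simp only [intervalIntegral]
  exact (h.integral_prod_right' (ν := volume.restrict (Set.Ioc 0 t))).measurable.sub
    (h.integral_prod_right' (ν := volume.restrict (Set.Ioc t 0))).measurable

theorem measurable_uncurry_pathIntegral [Finite S] (hT : 0 < T) (β : S → ℝ) :
    Measurable fun q : ℝ × PathSpace T S => pathIntegral hT β q.1 q.2 :=
  measurable_uncurry_of_continuous_of_measurable (u := fun t w => pathIntegral hT β t w)
    (fun w => continuous_pathIntegral hT β w) fun t => measurable_pathIntegral hT β t

theorem measurable_uncurry_dynkin [Finite S] (hT : 0 < T) (f β : S → ℝ) :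
    Measurable fun q : ℝ × PathSpace T S => dynkin hT f β q.1 q.2 :=
  ((measurable_uncurry_evalAt hT f).sub ((measurable_eval f _).comp measurable_snd)).sub
    (measurable_uncurry_pathIntegral hT β)

theorem abs_pathIntegral_le (hT : 0 < T) {β : S → ℝ} {B : ℝ} (hB : ∀ σ, |β σ| ≤ B) {t : ℝ}
    (ht : t ∈ Set.Icc 0 T) (w : PathSpace T S) : |pathIntegral hT β t w| ≤ T * B := by
  have hB0 : 0 ≤ B := (abs_nonneg _).trans (hB (evalAt hT w 0))
  have h := intervalIntegral.norm_integral_le_of_norm_le_const (a := 0) (b := t) (C := B)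
    (f := fun s => β (evalAt hT w s)) fun s _ => hB _
  rw [sub_zero, abs_of_nonneg ht.1] at h
  calc _ ≤ B * t := h
    _ ≤ T * B := by rw [mul_comm]; exact mul_le_mul_of_nonneg_right ht.2 hB0

theorem abs_dynkin_le (hT : 0 < T) {f β : S → ℝ} {B : ℝ} (hf : ∀ σ, |f σ| ≤ B)
    (hβ : ∀ σ, |β σ| ≤ B) {t : ℝ} (ht : t ∈ Set.Icc 0 T) (w : PathSpace T S) :
    |dynkin hT f β t w| ≤ 2 * B + T * B := by
  have h1 := abs_pathIntegral_le hT hβ ht w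
  have h2 := hf (evalAt hT w t)
  have h3 := hf (w.1 (timeZero hT))
  unfold dynkin
  rw [abs_le] at *
  constructor <;> linarith [h1.1, h1.2, h2.1, h2.2, h3.1, h3.2]

theorem eventually_evalAt_eq (hT : 0 < T) (w : PathSpace T S) {s : ℝ} (hs : s ∈ Set.Ioo 0 T) :
    ∀ᶠ u in 𝓝[>] s, evalAt hT w u = evalAt hT w s := by
  have h1 : Tendsto (Set.projIcc 0 T hT.le) (𝓝[>] s) (𝓝[>] (Set.projIcc 0 T hT.le s)) := by
    refine tendsto_nhdsWithin_iff.2 ⟨(continuous_projIcc.continuousAt).mono_left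
      nhdsWithin_le_nhds, ?_⟩
    filter_upwards [Ioo_mem_nhdsGT hs.2] with u hu
    rw [Set.projIcc_of_mem hT.le ⟨hs.1.le, hs.2.le⟩,
      Set.projIcc_of_mem hT.le ⟨(hs.1.trans hu.1).le, hu.2.le⟩]
    exact hu.1
  exact h1.eventually (w.2 _).1

/-- The integrand $\beta(w_s)$ is only right continuous, so $A_s=\int_0^s\beta(w_u)\,du$ is
differentiated from the right; this suffices for the fundamental theorem applied to $A^2$. -/
theorem integral_pathIntegral_mul [Finite S] (hT : 0 < T) (β : S → ℝ) (w : PathSpace T S) :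
    ∫ s in (0 : ℝ)..T, 2 * (pathIntegral hT β s w * β (evalAt hT w s)) =
      pathIntegral hT β T w ^ 2 := by
  have h := intervalIntegral.integral_eq_sub_of_hasDeriv_right (a := 0) (b := T)
    (f := fun t => pathIntegral hT β t w ^ 2)
    (f' := fun s => 2 * (pathIntegral hT β s w * β (evalAt hT w s)))
    ((continuous_pathIntegral hT β w).pow 2).continuousOn (fun s hs => ?_) ?_
  · rw [h]; simp [pathIntegral]
  · rw [min_eq_left hT.le, max_eq_right hT.le] at hs
    have h1 : HasDerivWithinAt (fun t => pathIntegral hT β t w) (β (evalAt hT w s)) (Set.Ici s) s :=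
      intervalIntegral.integral_hasDerivWithinAt_right (t := Set.Ioi s)
        (intervalIntegrable_evalAt hT β w 0 s)
        (measurable_evalAt hT β w).stronglyMeasurable.stronglyMeasurableAtFilter
        (tendsto_const_nhds.congr' (by
          filter_upwards [eventually_evalAt_eq hT w hs] with u hu
          rw [hu]))
    refine ((h1.mono Set.Ioi_subset_Ici_self).pow 2).congr_deriv ?_
    simp; ring
  · exact ((intervalIntegrable_evalAt hT β w 0 T).continuousOn_mul
      (continuous_pathIntegral hT β w).continuousOn).const_mul 2

/-- A pathwise substitute for the quadratic variation. With $q$ the drift of $f^2$, everything but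
the last term has mean zero, and the last term is the time integral of the carré du champ. -/
theorem dynkin_sq [Finite S] (hT : 0 < T) (f β q : S → ℝ) (w : PathSpace T S) :
    dynkin hT f β T w ^ 2 = dynkin hT (fun σ => f σ ^ 2) q T w
      - 2 * (f (w.1 (timeZero hT)) * dynkin hT f β T w)
      - 2 * (dynkin hT f β T w * pathIntegral hT β T w -
          ∫ s in (0 : ℝ)..T, dynkin hT f β s w * β (evalAt hT w s))
      + pathIntegral hT (fun σ => q σ - 2 * f σ * β σ) T w := by
  have hA := integral_pathIntegral_mul hT β w
  rw [intervalIntegral.integral_const_mul] at hA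
  have hβ := intervalIntegrable_evalAt hT β w 0 T
  have hfβ := intervalIntegrable_evalAt hT (fun σ => f σ * β σ) w 0 T
  have h1 : ∫ s in (0 : ℝ)..T, dynkin hT f β s w * β (evalAt hT w s) =
      pathIntegral hT (fun σ => f σ * β σ) T w
      - f (w.1 (timeZero hT)) * pathIntegral hT β T w - pathIntegral hT β T w ^ 2 / 2 := by
    simp only [dynkin, sub_mul]
    rw [intervalIntegral.integral_sub (hfβ.sub (hβ.const_mul _)) (hβ.continuousOn_mul
      (continuous_pathIntegral hT β w).continuousOn), intervalIntegral.integral_sub hfβ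
      (hβ.const_mul _), intervalIntegral.integral_const_mul]
    simp only [pathIntegral] at hA ⊢
    linear_combination (-1 / 2 : ℝ) * hA
  have h2 : pathIntegral hT (fun σ => q σ - 2 * f σ * β σ) T w =
      pathIntegral hT q T w - 2 * pathIntegral hT (fun σ => f σ * β σ) T w := by
    simp only [pathIntegral, mul_assoc]
    rw [intervalIntegral.integral_sub (intervalIntegrable_evalAt hT q w 0 T) (hfβ.const_mul _),
      intervalIntegral.integral_const_mul]
  rw [h1, h2]
  simp only [dynkin]
  ring

end Path

/-! ### The `L²` bound and the maximal inequality for Dynkin martingales -/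

section Dynkin

variable {T : ℝ} {S : Type}

theorem dynkin_coe (hT : 0 < T) (f β : S → ℝ) (t : Time T) (w : PathSpace T S) :
    dynkin hT f β t w =
      f (w.1 t) - f (w.1 (timeZero hT)) - timeIntegral (fun s => β (w.1 s)) t := by
  unfold dynkin evalAt
  rw [Set.projIcc_val]
  rfl

theorem dynkin_zero (hT : 0 < T) (f β : S → ℝ) (w : PathSpace T S) : dynkin hT f β 0 w = 0 := by
  have h := dynkin_coe hT f β (timeZero hT) w
  change dynkin hT f β 0 w = _ at h
  rw [h]
  simp [timeIntegral, timeZero]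

theorem exists_common_bound [Finite S] (f β : S → ℝ) :
    ∃ B, 0 ≤ B ∧ (∀ σ, |f σ| ≤ B) ∧ ∀ σ, |β σ| ≤ B := by
  obtain ⟨B, hB, hf⟩ := exists_abs_le f
  obtain ⟨B', hB', hβ⟩ := exists_abs_le β
  exact ⟨max B B', le_max_of_le_left hB, fun σ => (hf σ).trans (le_max_left _ _),
    fun σ => (hβ σ).trans (le_max_right _ _)⟩

theorem measurable_dynkin [Finite S] (hT : 0 < T) (f β : S → ℝ) (t : ℝ) :
    Measurable (dynkin hT f β t) :=
  (measurable_uncurry_dynkin hT f β).comp (measurable_const.prodMk measurable_id)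

variable {μ : Measure (PathSpace T S)} [IsProbabilityMeasure μ] {f β q : S → ℝ} {hT : 0 < T}

theorem integrable_of_abs_le {X : PathSpace T S → ℝ} (hX : Measurable X) {C : ℝ}
    (hC : ∀ w, |X w| ≤ C) : Integrable X μ :=
  Integrable.of_bound hX.aestronglyMeasurable C (.of_forall hC)

theorem integral_dynkin_eq_zero
    (hM : Martingale (fun (t : Time T) => dynkin hT f β t) (canonicalFiltration T S) μ)
    (t : Time T) : ∫ w, dynkin hT f β t w ∂μ = 0 := by
  have h := hM.2 (timeZero hT) t t.2.1
  rw [← integral_condExp ((canonicalFiltration T S).le (timeZero hT)), integral_congr_ae h]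
  simp [timeZero, dynkin_zero]

theorem integral_dynkin_mul_eval [Finite S]
    (hM : Martingale (fun (t : Time T) => dynkin hT f β t) (canonicalFiltration T S) μ)
    {s t : Time T} (hst : s ≤ t) :
    ∫ w, β (w.1 s) * dynkin hT f β t w ∂μ = ∫ w, β (w.1 s) * dynkin hT f β s w ∂μ := by
  obtain ⟨B, hB, hf, hβ⟩ := exists_common_bound f β
  have hint : Integrable ((fun w => β (w.1 s)) * fun w => dynkin hT f β t w) μ :=
    (hM.integrable t).bdd_mul (c := B) (measurable_eval β s).aestronglyMeasurable
      (.of_forall fun w => hβ _)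
  have h1 := condExp_mul_of_stronglyMeasurable_left (μ := μ)
    (measurable_canonicalFiltration_eval β le_rfl).stronglyMeasurable hint (hM.integrable t)
  rw [← integral_condExp ((canonicalFiltration T S).le s)]
  refine integral_congr_ae (h1.trans ?_)
  filter_upwards [hM.2 s t hst] with w hw
  rw [Pi.mul_apply, hw]

/-- By Fubini, it suffices to replace $M_T$ by $M_s$ against $\beta(w_s)$ at each time $s$, which is
the martingale property. -/
theorem integral_dynkin_mul_pathIntegral [Finite S]
    (hM : Martingale (fun (t : Time T) => dynkin hT f β t) (canonicalFiltration T S) μ) :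
    ∫ w, dynkin hT f β T w * pathIntegral hT β T w ∂μ =
      ∫ w, (∫ s in (0 : ℝ)..T, dynkin hT f β s w * β (evalAt hT w s)) ∂μ := by
  obtain ⟨B, hB, hf, hβ⟩ := exists_common_bound f β
  set D := 2 * B + T * B
  have hD : 0 ≤ D := by positivity
  have hbound {s : ℝ} (hs : s ∈ Set.Icc 0 T) (w : PathSpace T S) : |dynkin hT f β s w| ≤ D :=
    abs_dynkin_le hT hf hβ hs w
  have hTT : T ∈ Set.Icc 0 T := Set.right_mem_Icc.2 hT.le
  have hae : ∀ᵐ z : ℝ × PathSpace T S ∂((volume.restrict (Set.uIoc 0 T)).prod μ),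
      z.1 ∈ Set.Icc 0 T := by
    have h1 : ∀ᵐ s : ℝ ∂(volume.restrict (Set.uIoc 0 T)), s ∈ Set.Icc 0 T := by
      rw [Set.uIoc_of_le hT.le]
      filter_upwards [ae_restrict_mem measurableSet_Ioc] with s hs
      exact ⟨hs.1.le, hs.2⟩
    exact Measure.quasiMeasurePreserving_fst.ae h1
  have hfin : IsFiniteMeasure (volume.restrict (Set.uIoc 0 T)) :=
    ⟨by rw [Set.uIoc_of_le hT.le]; simp⟩
  have hi1 : Integrable (Function.uncurry fun (s : ℝ) (w : PathSpace T S) =>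
      dynkin hT f β T w * β (evalAt hT w s)) ((volume.restrict (Set.uIoc 0 T)).prod μ) := by
    refine Integrable.of_bound (C := D * B) (((measurable_dynkin hT f β T).comp
      measurable_snd).mul (measurable_uncurry_evalAt hT β)).aestronglyMeasurable
      (.of_forall fun z => ?_)
    simp only [Function.uncurry, Real.norm_eq_abs, abs_mul]
    exact mul_le_mul (hbound hTT _) (hβ _) (abs_nonneg _) hD
  have hi2 : Integrable (Function.uncurry fun (s : ℝ) (w : PathSpace T S) =>
      dynkin hT f β s w * β (evalAt hT w s)) ((volume.restrict (Set.uIoc 0 T)).prod μ) := by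
    refine Integrable.of_bound (C := D * B) ((measurable_uncurry_dynkin hT f β).mul
      (measurable_uncurry_evalAt hT β)).aestronglyMeasurable ?_
    filter_upwards [hae] with z hz
    simp only [Function.uncurry, Real.norm_eq_abs, abs_mul]
    exact mul_le_mul (hbound hz _) (hβ _) (abs_nonneg _) hD
  have h1 (w : PathSpace T S) : dynkin hT f β T w * pathIntegral hT β T w =
      ∫ s in (0 : ℝ)..T, dynkin hT f β T w * β (evalAt hT w s) := by
    rw [intervalIntegral.integral_const_mul]; rfl
  simp only [h1]
  rw [← intervalIntegral_integral_swap hi1, ← intervalIntegral_integral_swap hi2]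
  refine intervalIntegral.integral_congr fun s hs => ?_
  rw [Set.uIcc_of_le hT.le] at hs
  have h2 := integral_dynkin_mul_eval hM (s := ⟨s, hs⟩) (t := ⟨T, hTT⟩) hs.2
  simp only [evalAt, Set.projIcc_of_mem hT.le hs]
  simpa only [mul_comm] using h2

theorem integral_dynkin_sq_le [Finite S] {σ₀ : S} (h0 : ∀ᵐ w ∂μ, w.1 (timeZero hT) = σ₀)
    (hM : Martingale (fun (t : Time T) => dynkin hT f β t) (canonicalFiltration T S) μ)
    (hN : Martingale (fun (t : Time T) => dynkin hT (fun σ => f σ ^ 2) q t)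
      (canonicalFiltration T S) μ)
    {K : ℝ} (hK : ∀ σ, q σ - 2 * f σ * β σ ≤ K) :
    ∫ w, dynkin hT f β T w ^ 2 ∂μ ≤ T * K := by
  obtain ⟨B, hB, hf, hβ⟩ := exists_common_bound f β
  obtain ⟨B', hB', hg⟩ := exists_abs_le fun σ => q σ - 2 * f σ * β σ
  have hTT : T ∈ Set.Icc 0 T := Set.right_mem_Icc.2 hT.le
  set D := 2 * B + T * B
  have hbound {s : ℝ} (hs : s ∈ Set.Icc 0 T) (w : PathSpace T S) : |dynkin hT f β s w| ≤ D :=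
    abs_dynkin_le hT hf hβ hs w
  have hD : 0 ≤ D := by positivity
  have hMT : Integrable (fun w => dynkin hT f β T w) μ := hM.integrable ⟨T, hTT⟩
  have hNT : Integrable (fun w => dynkin hT (fun σ => f σ ^ 2) q T w) μ :=
    hN.integrable ⟨T, hTT⟩
  have hI1 : Integrable (fun w => dynkin hT f β T w * pathIntegral hT β T w) μ :=
    integrable_of_abs_le ((measurable_dynkin hT f β T).mul (measurable_pathIntegral hT β T))
      (C := D * (T * B)) fun w => by
        rw [abs_mul]
        exact mul_le_mul (hbound hTT w) (abs_pathIntegral_le hT hβ hTT w) (abs_nonneg _) hD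
  have hI2 : Integrable (fun w => ∫ s in (0 : ℝ)..T, dynkin hT f β s w * β (evalAt hT w s)) μ := by
    have hm := ((measurable_uncurry_dynkin hT f β).mul
      (measurable_uncurry_evalAt hT β)).comp measurable_swap
    refine integrable_of_abs_le (C := D * B * |T - 0|) ?_ fun w => ?_
    · simp only [intervalIntegral]
      exact (hm.stronglyMeasurable.integral_prod_right'
        (ν := volume.restrict (Set.Ioc 0 T))).measurable.sub
        (hm.stronglyMeasurable.integral_prod_right' (ν := volume.restrict (Set.Ioc T 0))).measurable
    · refine intervalIntegral.norm_integral_le_of_norm_le_const (f := fun s =>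
        dynkin hT f β s w * β (evalAt hT w s)) fun s hs => ?_
      rw [Set.uIoc_of_le hT.le] at hs
      rw [Real.norm_eq_abs, abs_mul]
      exact mul_le_mul (hbound ⟨hs.1.le, hs.2⟩ w) (hβ _) (abs_nonneg _) hD
  have hI3 : Integrable (fun w => pathIntegral hT (fun σ => q σ - 2 * f σ * β σ) T w) μ :=
    integrable_of_abs_le (measurable_pathIntegral hT _ T) (C := T * B')
      fun w => abs_pathIntegral_le hT hg hTT w
  have hle : ∫ w, pathIntegral hT (fun σ => q σ - 2 * f σ * β σ) T w ∂μ ≤ T * K := by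
    have : ∫ w, pathIntegral hT (fun σ => q σ - 2 * f σ * β σ) T w ∂μ ≤ ∫ _w, T * K ∂μ := by
      refine integral_mono hI3 (integrable_const _) fun w => ?_
      have := intervalIntegral.integral_mono_on hT.le
        (intervalIntegrable_evalAt hT (fun σ => q σ - 2 * f σ * β σ) w 0 T)
        (intervalIntegrable_const (c := K)) fun s _ => hK (evalAt hT w s)
      exact this.trans_eq (by simp)
    simpa using this
  have heq : ∀ᵐ w ∂μ, dynkin hT f β T w ^ 2 = dynkin hT (fun σ => f σ ^ 2) q T w
      - 2 * (f σ₀ * dynkin hT f β T w)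
      - 2 * (dynkin hT f β T w * pathIntegral hT β T w -
          ∫ s in (0 : ℝ)..T, dynkin hT f β s w * β (evalAt hT w s))
      + pathIntegral hT (fun σ => q σ - 2 * f σ * β σ) T w := by
    filter_upwards [h0] with w hw
    rw [dynkin_sq hT f β q w, hw]
  have hE1 : ∫ w, dynkin hT f β T w ∂μ = 0 := integral_dynkin_eq_zero hM ⟨T, hTT⟩
  have hE2 : ∫ w, dynkin hT (fun σ => f σ ^ 2) q T w ∂μ = 0 :=
    integral_dynkin_eq_zero hN ⟨T, hTT⟩
  have hJ1 : Integrable (fun w => 2 * (f σ₀ * dynkin hT f β T w)) μ :=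
    (hMT.const_mul _).const_mul _
  have hJ2 : Integrable (fun w => 2 * (dynkin hT f β T w * pathIntegral hT β T w -
          ∫ s in (0 : ℝ)..T, dynkin hT f β s w * β (evalAt hT w s))) μ :=
    (hI1.sub hI2).const_mul _
  have hJ3 : Integrable (fun w => dynkin hT (fun σ => f σ ^ 2) q T w
      - 2 * (f σ₀ * dynkin hT f β T w)) μ := hNT.sub hJ1
  have hJ4 : Integrable (fun w => dynkin hT (fun σ => f σ ^ 2) q T w
      - 2 * (f σ₀ * dynkin hT f β T w)
      - 2 * (dynkin hT f β T w * pathIntegral hT β T w -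
          ∫ s in (0 : ℝ)..T, dynkin hT f β s w * β (evalAt hT w s))) μ := hJ3.sub hJ2
  rw [integral_congr_ae heq, integral_add hJ4 hI3, integral_sub hJ3 hJ2, integral_sub hNT hJ1, integral_const_mul, integral_const_mul,
    integral_const_mul, integral_sub hI1 hI2, integral_dynkin_mul_pathIntegral hM, hE1, hE2]
  simpa using hle

theorem continuousWithinAt_dynkin [Finite S] (hT : 0 < T) (f β : S → ℝ) (w : PathSpace T S)
    (t : Time T) : ContinuousWithinAt (fun s : Time T => dynkin hT f β s w) (Set.Ioi t) t := by
  have h1 : ContinuousWithinAt (fun s : Time T => f (w.1 s)) (Set.Ioi t) t :=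
    tendsto_const_nhds.congr' (by
      filter_upwards [(w.2 t).1] with s hs
      rw [hs])
  have h2 : Continuous fun s : Time T => pathIntegral hT β s w :=
    (continuous_pathIntegral hT β w).comp continuous_subtype_val
  have h3 := (h1.sub (continuousWithinAt_const (b := f (w.1 (timeZero hT))))).sub
    h2.continuousWithinAt
  refine h3.congr (fun s _ => ?_) ?_ <;>
  · rw [dynkin_coe]; rfl

theorem measure_exists_lt_abs_dynkin_le [Finite S] {σ₀ : S}
    (h0 : ∀ᵐ w ∂μ, w.1 (timeZero hT) = σ₀)
    (hM : Martingale (fun (t : Time T) => dynkin hT f β t) (canonicalFiltration T S) μ)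
    (hN : Martingale (fun (t : Time T) => dynkin hT (fun σ => f σ ^ 2) q t)
      (canonicalFiltration T S) μ)
    {K : ℝ} (hK : ∀ σ, q σ - 2 * f σ * β σ ≤ K) {ε : ℝ} (hε : 0 < ε) :
    μ {w | ∃ t : Time T, ε < |dynkin hT f β t w|} ≤ ENNReal.ofReal (√(T * K) / ε) := by
  refine (measure_exists_lt_abs_le hT hM (fun w t => continuousWithinAt_dynkin hT f β w t)
    hε).trans (ENNReal.ofReal_le_ofReal ?_)
  obtain ⟨B, hB, hf, hβ⟩ := exists_common_bound f β
  have hL : MemLp (fun w => |dynkin hT f β T w|) 2 μ :=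
    MemLp.of_bound (measurable_dynkin hT f β T).abs.aestronglyMeasurable (2 * B + T * B)
      (.of_forall fun w => by
        rw [Real.norm_eq_abs, abs_abs]
        exact abs_dynkin_le hT hf hβ (Set.right_mem_Icc.2 hT.le) w)
  -- Nonnegativity of the variance of $|M_T|$ bounds the $L^1$ norm in Doob's inequality by the
  -- $L^2$ norm.
  have hvar := variance_nonneg (fun w => |dynkin hT f β T w|) μ
  rw [variance_eq_sub hL] at hvar
  have hsq := integral_dynkin_sq_le h0 hM hN hK
  gcongr
  refine Real.le_sqrt_of_sq_le ?_
  simp only [Pi.pow_apply, sq_abs] at hvar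
  linarith

end Dynkin

/-! ### Coloured empirical averages -/

section Coloured

variable {d n : ℕ} [NeZero n] {J : Torus d → ℝ} {θ : ℝ} {a p : Fin 2 → ℝ}
  {α : (Fin d → ℤ) → ℝ}

/-- The pairing `γ^d ∑_x g(γx) α_i(x) σ(x)` of one coloured empirical measure. -/
def colourMean (a : Fin 2 → ℝ) (α : (Fin d → ℤ) → ℝ) (i : Fin 2) (g : Torus d → ℝ)
    (σ : Config d n) : ℝ :=
  siteMean fun x => g (toTorus x) * colour n a α i x * spin σ x

/-- The nonlinear part `γ^d ∑_x g(γx) α_i(x) tanh(h_x(σ) + θ α(x))` of the drift. -/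
def colourDrift (J : Torus d → ℝ) (θ : ℝ) (a : Fin 2 → ℝ) (α : (Fin d → ℤ) → ℝ) (i : Fin 2)
    (g : Torus d → ℝ) (σ : Config d n) : ℝ :=
  siteMean fun x =>
    g (toTorus x) * colour n a α i x * Real.tanh (localField J σ x + θ * latticeField n α x)

omit [NeZero n] in
theorem colour_nonneg (i : Fin 2) (x : Site d n) : 0 ≤ colour n a α i x := by
  unfold colour; split_ifs <;> simp

omit [NeZero n] in
theorem colour_le_one (i : Fin 2) (x : Site d n) : colour n a α i x ≤ 1 := by
  unfold colour; split_ifs <;> simp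

omit [NeZero n] in
theorem abs_colour_le_one (i : Fin 2) (x : Site d n) : |colour n a α i x| ≤ 1 := by
  rw [abs_of_nonneg (colour_nonneg i x)]; exact colour_le_one i x

omit [NeZero n] in
theorem colour_add (ha : a 0 ≠ a 1) (hα : ∀ z, α z = a 0 ∨ α z = a 1) (x : Site d n) :
    colour n a α 0 x + colour n a α 1 x = 1 := by
  unfold colour
  rcases hα fun j => (x j).valMinAbs with h | h
  · have h' : latticeField n α x = a 0 := h
    simp [h', ha]
  · have h' : latticeField n α x = a 1 := h
    simp [h', ha.symm]

omit [NeZero n] in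
theorem abs_mul_colour_le {g : Torus d → ℝ} {B : ℝ} (hg : ∀ r, |g r| ≤ B) (i : Fin 2)
    (r : Torus d) (x : Site d n) : |g r * colour n a α i x| ≤ B := by
  rw [abs_mul, ← mul_one B]
  exact mul_le_mul (hg _) (abs_colour_le_one i x) (abs_nonneg _) ((abs_nonneg _).trans (hg r))

theorem generator_colourMean (hJ : ∀ r, J (-r) = J r) (i : Fin 2) (g : Torus d → ℝ)
    (σ : Config d n) :
    generator J θ α (colourMean a α i g) σ = -colourMean a α i g σ + colourDrift J θ a α i g σ :=
  generator_siteMean hJ _ σ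

theorem abs_colourMean_sub_le {g g' : Torus d → ℝ} {ε : ℝ} (h : ∀ r, |g r - g' r| ≤ ε) (i : Fin 2)
    (σ : Config d n) : |colourMean a α i g σ - colourMean a α i g' σ| ≤ ε := by
  refine abs_siteMean_sub_le fun x => ?_
  rw [← sub_mul, ← sub_mul, abs_mul, abs_spin, mul_one]
  exact abs_mul_colour_le (g := fun r => g r - g' r) h i _ x

theorem abs_colourMean_le {g : Torus d → ℝ} {B : ℝ} (hg : ∀ r, |g r| ≤ B) (i : Fin 2)
    (σ : Config d n) : |colourMean a α i g σ| ≤ B := by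
  refine abs_siteMean_le fun x => ?_
  rw [abs_mul, abs_spin, mul_one]
  exact abs_mul_colour_le hg i _ x

theorem kacField_eq_colourMean (ha : a 0 ≠ a 1) (hα : ∀ z, α z = a 0 ∨ α z = a 1)
    (σ : Config d n) (r : Torus d) :
    kacField J σ r = colourMean a α 0 (fun r' => J (r - r')) σ +
      colourMean a α 1 (fun r' => J (r - r')) σ := by
  unfold kacField colourMean
  rw [← siteMean_add]
  congr 1
  funext x
  linear_combination (-(J (r - toTorus x) * spin σ x)) * colour_add (n := n) ha hα x

theorem carre_du_champ_colourMean_le (hJ : ∀ r, J (-r) = J r) {g : Torus d → ℝ} {B : ℝ}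
    (hg : ∀ r, |g r| ≤ B) (i : Fin 2) (σ : Config d n) :
    generator J θ α (fun η => colourMean a α i g η ^ 2) σ -
      2 * colourMean a α i g σ * generator J θ α (colourMean a α i g) σ ≤
      ((n : ℝ)⁻¹) ^ d * (2 * B) ^ 2 := by
  refine (carre_du_champ_le hJ (b := ((n : ℝ)⁻¹) ^ d * (2 * B)) (fun σ x =>
    abs_siteMean_flip_sub_le (fun x => abs_mul_colour_le hg i _ x) σ x) σ).trans_eq ?_
  have hn : (n : ℝ) ≠ 0 := NeZero.ne _
  have h : (n : ℝ) ^ d * ((n : ℝ)⁻¹) ^ d = 1 := by rw [← mul_pow, mul_inv_cancel₀ hn, one_pow]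
  linear_combination (((n : ℝ)⁻¹) ^ d * (2 * B) ^ 2) * h

theorem continuous_kacField (hJ : Continuous J) (σ : Config d n) : Continuous (kacField J σ) := by
  unfold kacField siteMean
  fun_prop

end Coloured

/-! ### Uniform replacement of the drift -/

section Replacement

variable {d : ℕ} {J : Torus d → ℝ} {θ : ℝ} {a p : Fin 2 → ℝ} {α : (Fin d → ℤ) → ℝ}

theorem exists_abs_le_of_continuous {g : Torus d → ℝ} (hg : Continuous g) :
    ∃ B, 0 ≤ B ∧ ∀ r, |g r| ≤ B := by
  obtain ⟨B, hB⟩ := (isCompact_range hg.abs).bddAbove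
  exact ⟨max B 0, le_max_right _ _, fun r => (hB ⟨r, rfl⟩).trans (le_max_left _ _)⟩

/-- The fields `J * π(σ)` lie in a totally bounded set of continuous functions. -/
theorem exists_finite_net_kacField (hJ : Continuous J) {ε : ℝ} (hε : 0 < ε) :
    ∃ t : Set (BoundedContinuousFunction (Torus d) ℝ), t.Finite ∧
      ∀ (k : ℕ) (σ : Config d (2 * k + 1)), ∃ h ∈ t, ∀ r, |kacField J σ r - h r| ≤ ε := by
  obtain ⟨B, hB, hJB⟩ := exists_abs_le_of_continuous hJ
  -- Configurations of all sizes form a single family, so that the net serves every $k$ and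
  -- $\sigma$. The fields share the sup bound and the modulus of continuity of $J$, whence
  -- Arzelà–Ascoli applies.
  let Φ : (Σ k : ℕ, Config d (2 * k + 1)) → BoundedContinuousFunction (Torus d) ℝ := fun z =>
    BoundedContinuousFunction.mkOfCompact ⟨kacField J z.2, continuous_kacField hJ z.2⟩
  have hcomp : IsCompact (closure (Set.range Φ)) := by
    refine BoundedContinuousFunction.arzela_ascoli (Set.Icc (-B) B) isCompact_Icc _ ?_ ?_
    · rintro _ x ⟨z, rfl⟩
      refine abs_le.1 (abs_siteMean_le fun y => ?_)
      rw [abs_mul, abs_spin, mul_one]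
      exact hJB _
    · intro r₀
      rw [Metric.equicontinuousAt_iff]
      intro ε hε
      obtain ⟨η, hη, h⟩ := Metric.uniformContinuous_iff.1
        (CompactSpace.uniformContinuous_of_continuous hJ) (ε / 2) (half_pos hε)
      refine ⟨η, hη, ?_⟩
      rintro r hr ⟨_, z, rfl⟩
      have : |kacField J z.2 r₀ - kacField J z.2 r| ≤ ε / 2 := by
        refine abs_siteMean_sub_le fun y => ?_
        rw [← sub_mul, abs_mul, abs_spin, mul_one]
        exact (h (by rwa [dist_sub_right, dist_comm])).le
      exact this.trans_lt (half_lt_self hε)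
  obtain ⟨t, ht, hcov⟩ := Metric.totallyBounded_iff.1
    (hcomp.totallyBounded.subset subset_closure) ε hε
  refine ⟨t, ht, fun k σ => ?_⟩
  obtain ⟨h, hh, hball⟩ := Set.mem_iUnion₂.1 (hcov ⟨⟨k, σ⟩, rfl⟩)
  exact ⟨h, hh, fun r => ((BoundedContinuousFunction.dist_coe_le_dist r).trans
    (Metric.mem_ball.1 hball).le)⟩

theorem colour_mul_tanh {n : ℕ} (i : Fin 2) (x : Site d n) (v : ℝ) :
    colour n a α i x * Real.tanh (v + θ * latticeField n α x) =
      colour n a α i x * Real.tanh (v + a i * θ) := by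
  unfold colour
  split_ifs with h
  · rw [h, mul_comm θ]
  · simp

theorem abs_mul_tanh_sub_le {c B u v ε : ℝ} (hB : 0 ≤ B) (hc : |c| ≤ B) (h : |u - v| ≤ ε) :
    |c * Real.tanh u - c * Real.tanh v| ≤ B * ε := by
  rw [← mul_sub, abs_mul]
  exact mul_le_mul hc ((abs_tanh_sub_tanh_le u v).trans h) (abs_nonneg _) hB

theorem abs_integral_sub_le {u v : Torus d → ℝ} (hu : Integrable u) (hv : Integrable v) {C : ℝ}
    (h : ∀ r, |u r - v r| ≤ C) : |(∫ r, u r) - ∫ r, v r| ≤ C := by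
  rw [← integral_sub hu hv]
  simpa using norm_integral_le_of_norm_le_const (μ := (volume : Measure (Torus d)))
    (f := fun r => u r - v r) (.of_forall h)

/-- The threshold in $k$ does not depend on $\sigma$: the field $J*\pi(\sigma)$ is replaced by a
member $h$ of a finite net, and the law of large numbers is used only for the finitely many
functions $g\tanh(h+a_i\theta)$. -/
theorem eventually_forall_abs_colourDrift_sub_le (hd : 1 ≤ d) (hJ : Continuous J) {i : Fin 2}
    (hp : 0 ≤ p i) (hp_le : p i ≤ 1)
    (hα : ∀ g : Torus d → ℝ, Continuous g → Tendsto
      (fun k => siteMean fun x => g (toTorus x) * colour (2 * k + 1) a α i x) atTop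
      (𝓝 (p i * ∫ r, g r)))
    {g : Torus d → ℝ} (hg : Continuous g) {ε : ℝ} (hε : 0 < ε) :
    ∀ᶠ k in atTop, ∀ σ : Config d (2 * k + 1),
      |colourDrift J θ a α i g σ - p i * ∫ r, g r * Real.tanh (kacField J σ r + a i * θ)| ≤ ε := by
  obtain ⟨B, hB, hgB⟩ := exists_abs_le_of_continuous hg
  -- Total error: $2B\varepsilon'$ (self-interaction and net, inside the sum), $\varepsilon'$ (law
  -- of large numbers), $B\varepsilon'$ (net, inside the integral).
  set ε' := ε / (3 * B + 1)
  have hε' : 0 < ε' := by positivity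
  obtain ⟨t, ht, hnet⟩ := exists_finite_net_kacField hJ hε'
  have hcont (h : Torus d → ℝ) (hh : Continuous h) :
      Continuous fun r => g r * Real.tanh (h r + a i * θ) :=
    hg.mul (continuous_tanh.comp (hh.add continuous_const))
  have h1 : ∀ᶠ k in atTop, ∀ h ∈ t,
      |(siteMean fun x => g (toTorus x) * Real.tanh (h (toTorus x) + a i * θ) *
        colour (2 * k + 1) a α i x) - p i * ∫ r, g r * Real.tanh (h r + a i * θ)| < ε' := by
    rw [eventually_all_finite ht]
    intro h _
    have := Metric.tendsto_nhds.1 (hα _ (hcont h h.continuous)) ε' hε'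
    simpa only [Real.dist_eq] using this
  have h2 : ∀ᶠ k : ℕ in atTop, (((2 * k + 1 : ℕ) : ℝ)⁻¹) ^ d * |J 0| < ε' := by
    have := (tendsto_inv_odd.pow d).mul_const |J 0|
    rw [zero_pow (by omega), zero_mul] at this
    exact this.eventually_lt_const hε'
  filter_upwards [h1, h2] with k hk1 hk2 σ
  obtain ⟨h, hh, hclose⟩ := hnet k σ
  have e1 : |colourDrift J θ a α i g σ - siteMean fun x => g (toTorus x) *
      Real.tanh (h (toTorus x) + a i * θ) * colour (2 * k + 1) a α i x| ≤ B * (2 * ε') := by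
    refine abs_siteMean_sub_le fun x => ?_
    rw [mul_assoc, colour_mul_tanh, ← mul_assoc, mul_right_comm (g _) (Real.tanh (h _ + _))]
    refine abs_mul_tanh_sub_le hB (abs_mul_colour_le hgB i _ x) ?_
    rw [add_sub_add_right_eq_sub]
    have := abs_localField_sub_kacField_le (J := J) σ x
    calc _ ≤ |localField J σ x - kacField J σ (toTorus x)| +
          |kacField J σ (toTorus x) - h (toTorus x)| := abs_sub_le _ _ _
      _ ≤ ε' + ε' := add_le_add (this.trans hk2.le) (hclose _)
      _ = _ := by ring
  have e2 : |(p i * ∫ r, g r * Real.tanh (h r + a i * θ)) -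
      p i * ∫ r, g r * Real.tanh (kacField J σ r + a i * θ)| ≤ B * ε' := by
    rw [← mul_sub, abs_mul, abs_of_nonneg hp]
    refine (mul_le_of_le_one_left (abs_nonneg _) hp_le).trans ?_
    refine abs_integral_sub_le (integrable_of_continuous (hcont h h.continuous))
      (integrable_of_continuous (hcont _ (continuous_kacField hJ σ))) fun r => ?_
    refine abs_mul_tanh_sub_le hB (hgB r) ?_
    rw [add_sub_add_right_eq_sub, abs_sub_comm]
    exact hclose r
  calc _ ≤ B * (2 * ε') + ε' + B * ε' := by
        have e3 := (hk1 h hh).le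
        rw [abs_le] at *
        constructor <;> linarith [e1.1, e1.2, e2.1, e2.2, e3.1, e3.2]
    _ = ε' * (3 * B + 1) := by ring
    _ = ε := div_mul_cancel₀ _ (by positivity)

end Replacement

/-! ### Weak solutions -/

section Weak

variable {d : ℕ} {T : ℝ} {J : Torus d → ℝ} {θ : ℝ} {a p : Fin 2 → ℝ} {m₀ : Torus d → ℝ}
  {m : Fin 2 → Time T → Torus d → ℝ}

/-- The field `J * (m₁ + m₂)(s)`. -/
def limitField (J : Torus d → ℝ) (m : Fin 2 → Time T → Torus d → ℝ) (s : Time T) (r : Torus d) :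
    ℝ :=
  conv J (fun r' => m 0 s r' + m 1 s r') r

/-- The drift of `∫ g m_i` at time `s`. -/
def limitDrift (J : Torus d → ℝ) (θ : ℝ) (a p : Fin 2 → ℝ) (m : Fin 2 → Time T → Torus d → ℝ)
    (i : Fin 2) (g : Torus d → ℝ) (s : Time T) : ℝ :=
  ∫ r, g r * (-m i s r + p i * Real.tanh (limitField J m s r + a i * θ))

theorem IsWeakSolution.measurable_limitField (hm : IsWeakSolution J θ a p m₀ m)
    (hJ : Continuous J) : Measurable fun q : Time T × Torus d => limitField J m q.1 q.2 := by
  have h : Measurable fun z : (Time T × Torus d) × Torus d =>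
      J (z.1.2 - z.2) * (m 0 z.1.1 z.2 + m 1 z.1.1 z.2) := by
    have h1 : Measurable fun z : (Time T × Torus d) × Torus d => (z.1.1, z.2) := by fun_prop
    exact (hJ.measurable.comp (by fun_prop)).mul
      (((hm.measurable 0).comp h1).add ((hm.measurable 1).comp h1))
  exact (h.stronglyMeasurable.integral_prod_right' (ν := volume)).measurable

theorem IsWeakSolution.measurable_limitDrift (hm : IsWeakSolution J θ a p m₀ m)
    (hJ : Continuous J) (i : Fin 2) {g : Torus d → ℝ} (hg : Continuous g) :
    Measurable (limitDrift J θ a p m i g) := by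
  have h : Measurable fun q : Time T × Torus d =>
      g q.2 * (-m i q.1 q.2 + p i * Real.tanh (limitField J m q.1 q.2 + a i * θ)) :=
    (hg.measurable.comp measurable_snd).mul ((hm.measurable i).neg.add
      ((continuous_tanh.measurable.comp ((hm.measurable_limitField hJ).add_const _)).const_mul _))
  exact (h.stronglyMeasurable.integral_prod_right' (ν := volume)).measurable

theorem IsWeakSolution.integrable_mul (hm : IsWeakSolution J θ a p m₀ m) {g : Torus d → ℝ}
    (hg : Continuous g) (i : Fin 2) (s : Time T) : Integrable fun r => g r * m i s r := by
  obtain ⟨C, hC⟩ := hm.bounded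
  have h1 : Measurable (m i s) := (hm.measurable i).comp (measurable_const.prodMk measurable_id)
  exact (integrable_of_continuous hg).mul_bdd (c := C) h1.aestronglyMeasurable (hC i s)

theorem IsWeakSolution.limitField_eq (hm : IsWeakSolution J θ a p m₀ m) (hJ : Continuous J)
    (s : Time T) (r : Torus d) :
    limitField J m s r = (∫ r', J (r - r') * m 0 s r') + ∫ r', J (r - r') * m 1 s r' := by
  have h : Continuous fun r' => J (r - r') := by fun_prop
  rw [← integral_add (hm.integrable_mul h 0 s) (hm.integrable_mul h 1 s)]
  simp only [limitField, conv, mul_add]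

theorem integrable_mul_tanh {g u : Torus d → ℝ} (hg : Continuous g) (hu : Measurable u) :
    Integrable fun r => g r * Real.tanh (u r) :=
  (integrable_of_continuous hg).mul_bdd (c := 1) (continuous_tanh.measurable.comp hu).aestronglyMeasurable
    (.of_forall fun _ => abs_tanh_le_one _)

theorem IsWeakSolution.limitDrift_eq (hm : IsWeakSolution J θ a p m₀ m) (hJ : Continuous J)
    (i : Fin 2) {g : Torus d → ℝ} (hg : Continuous g) (s : Time T) :
    limitDrift J θ a p m i g s = -(∫ r, g r * m i s r) +
      p i * ∫ r, g r * Real.tanh (limitField J m s r + a i * θ) := by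
  have hu : Measurable fun r => limitField J m s r + a i * θ :=
    ((hm.measurable_limitField hJ).comp (measurable_const.prodMk measurable_id)).add_const _
  have h := integrable_mul_tanh hg hu
  have h1 : Integrable fun r => -(g r * m i s r) := (hm.integrable_mul hg i s).neg
  rw [← integral_neg, ← integral_const_mul, ← integral_add h1 (h.const_mul _)]
  unfold limitDrift
  congr 1
  funext r
  ring

theorem abs_integral_mul_le {C : ℝ} {v : Torus d → ℝ} (hv : ∀ᵐ r, |v r| ≤ C) {g : Torus d → ℝ}
    {B : ℝ} (hB : 0 ≤ B) (hg : ∀ r, |g r| ≤ B) : |∫ r, g r * v r| ≤ B * C := by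
  have h := norm_integral_le_of_norm_le_const (μ := (volume : Measure (Torus d)))
    (f := fun r => g r * v r) (C := B * C) (by
      filter_upwards [hv] with r hr
      rw [Real.norm_eq_abs, abs_mul]
      exact mul_le_mul (hg r) hr (abs_nonneg _) hB)
  simpa using h

theorem IsWeakSolution.integral_mul_eq (hm : IsWeakSolution J θ a p m₀ m) (hT : 0 < T)
    (i : Fin 2) {g : Torus d → ℝ} (hg : Continuous g) (t : Time T) :
    ∫ r, g r * m i t r = p i * (∫ r, g r * m₀ r) +
      ∫ s in (0 : ℝ)..t, limitDrift J θ a p m i g (Set.projIcc 0 T hT.le s) := by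
  rw [hm.weak i g hg t, ← integral_const_mul]
  congr 2
  funext r
  ring

end Weak

/-! ### The Gronwall estimate along a path -/

/-- Continuity of the periodic lift descends along the open quotient map $\mathbb R^d\to\Lambda$. -/
theorem IsC1.continuous {d : ℕ} {J : Torus d → ℝ} (hJ : IsC1 J) : Continuous J := by
  have h : IsOpenQuotientMap (Pi.map fun (_ : Fin d) (x : ℝ) => (x : UnitAddCircle)) :=
    IsOpenQuotientMap.piMap fun _ => QuotientAddGroup.isOpenQuotientMap_mk
  exact h.isQuotientMap.continuous_iff.2 (ContDiff.continuous hJ)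

/-- The map $A\mapsto\eta+A/2$ contracts to its fixed point $2\eta$. This runs Gronwall's argument
on a priori bounds alone, with no supremum over time or test functions to be shown measurable. -/
theorem le_of_halving {P : ℝ → Prop} {A η b : ℝ} (hA : 0 ≤ A) (hη : 0 ≤ η)
    (h0 : P (2 * η + A)) (hstep : ∀ A, 0 ≤ A → P A → P (η + A / 2)) {x c : ℝ}
    (hP : ∀ A, P A → x ≤ A * c) (hb : b = 2 * η * c) : x ≤ b := by
  have h (k : ℕ) : P (2 * η + A * (1 / 2) ^ k) := by
    induction k with
    | zero => simpa using h0
    | succ k ih =>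
      have := hstep _ (by positivity) ih
      convert this using 1
      rw [pow_succ]; ring
  have hlim : Tendsto (fun k : ℕ => (2 * η + A * (1 / 2 : ℝ) ^ k) * c) atTop
      (𝓝 ((2 * η + A * 0) * c)) :=
    (((tendsto_pow_atTop_nhds_zero_of_lt_one (by norm_num) (by norm_num)).const_mul A).const_add
      _).mul_const c
  rw [hb]
  simpa using ge_of_tendsto' hlim fun k => hP _ (h k)

theorem integral_const_mul_exp_add {l : ℝ} (hl : 0 < l) (A c t : ℝ) :
    ∫ s in (0 : ℝ)..t, (A * Real.exp (l * s) + c) = A * ((Real.exp (l * t) - 1) / l) + c * t := by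
  have h := intervalIntegral.integral_eq_sub_of_hasDerivAt (a := 0) (b := t)
    (f := fun s => A * (Real.exp (l * s) / l) + c * s)
    (f' := fun s => A * Real.exp (l * s) + c) (fun s _ => ?_)
    (Continuous.intervalIntegrable (by fun_prop) _ _)
  · rw [h]; simp; ring
  · have h1 : HasDerivAt (fun s => Real.exp (l * s)) (Real.exp (l * s) * l) s := by
      simpa using ((hasDerivAt_id s).const_mul l).exp
    refine (((h1.div_const l).const_mul A).add ((hasDerivAt_id s).const_mul c)).congr_deriv ?_
    field_simp

section Gronwall

variable {d : ℕ} {T : ℝ} {J : Torus d → ℝ} {θ : ℝ} {a p : Fin 2 → ℝ} {m₀ : Torus d → ℝ}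
  {m : Fin 2 → Time T → Torus d → ℝ} {α : (Fin d → ℤ) → ℝ}

/-- The stability constant of the Gronwall estimate. -/
def stabilityConst (B C T : ℝ) : ℝ :=
  2 * (2 + (1 + 2 * B * (1 + C)) * T) * Real.exp (2 * (1 + 2 * B) * T)

/-- A deterministic stability estimate for one path. The inequality closes because `hnet` puts an
approximation of every $J(r-\cdot)$ in $F$, so bounds on $F$ at time $s$ control the field
difference at time $s$. -/
theorem abs_colourMean_sub_le_stabilityConst (hT : 0 < T) (hJ : Continuous J)
    (hJs : ∀ r, J (-r) = J r) (ha : a 0 ≠ a 1) (hp : ∀ i, 0 ≤ p i) (hp_le : ∀ i, p i ≤ 1)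
    (hα : ∀ z, α z = a 0 ∨ α z = a 1) (hm : IsWeakSolution J θ a p m₀ m)
    {C : ℝ} (hC0 : 0 ≤ C) (hC : ∀ i t, ∀ᵐ r, |m i t r| ≤ C)
    {n : ℕ} [NeZero n] (w : PathSpace T (Config d n)) {F : Set (Torus d → ℝ)} {B ε : ℝ}
    (hε : 0 ≤ ε) (hB : 0 ≤ B) (hFc : ∀ g ∈ F, Continuous g) (hFB : ∀ g ∈ F, ∀ r, |g r| ≤ B)
    (hnet : ∀ r, ∃ g ∈ F, ∀ r', |J (r - r') - g r'| ≤ ε)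
    (hinit : ∀ i, ∀ g ∈ F,
      |colourMean a α i g (w.1 (timeZero hT)) - p i * ∫ r, g r * m₀ r| ≤ ε)
    (hmart : ∀ i, ∀ g ∈ F, ∀ t : Time T,
      |dynkin hT (colourMean a α i g) (generator J θ α (colourMean a α i g)) t w| ≤ ε)
    (hdrift : ∀ i, ∀ g ∈ F, ∀ σ : Config d n,
      |colourDrift J θ a α i g σ - p i * ∫ r, g r * Real.tanh (kacField J σ r + a i * θ)| ≤ ε)
    (i : Fin 2) {g : Torus d → ℝ} (hg : g ∈ F) (t : Time T) :
    |colourMean a α i g (w.1 t) - ∫ r, g r * m i t r| ≤ stabilityConst B C T * ε := by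
  set dev : Fin 2 → (Torus d → ℝ) → Time T → ℝ := fun i g t =>
    colourMean a α i g (w.1 t) - ∫ r, g r * m i t r with hdev
  -- Twice the Lipschitz constant of the drift: integrating $(1+2B)Ae^{ls}$ then gains exactly a
  -- factor $1/2$.
  set l := 2 * (1 + 2 * B) with hl
  have hl0 : 0 < l := by positivity
  set c := 1 + 2 * B * (1 + C) with hc
  have hc0 : 0 ≤ c := by positivity
  -- One $\varepsilon$ each for the initial condition and the martingale, and $c\,\varepsilon T$ for
  -- the accumulated drift error.
  set η := (2 + c * T) * ε with hη
  have hη0 : 0 ≤ η := by positivity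
  have hcrude : ∀ i, ∀ g ∈ F, ∀ t, |dev i g t| ≤ B + B * C := fun i g hg t =>
    (abs_sub _ _).trans (add_le_add (abs_colourMean_le (hFB g hg) i _)
      (abs_integral_mul_le (hC i t) hB (hFB g hg)))
  have hfield (A : ℝ) (s : Time T) (hA : ∀ i, ∀ g ∈ F, |dev i g s| ≤ A) (r : Torus d) :
      |kacField J (w.1 s) r - limitField J m s r| ≤ 2 * A + 2 * (1 + C) * ε := by
    obtain ⟨g, hg, hclose⟩ := hnet r
    have hJr : Continuous fun r' => J (r - r') := by fun_prop
    have key (i : Fin 2) : |colourMean a α i (fun r' => J (r - r')) (w.1 s) -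
        ∫ r', J (r - r') * m i s r'| ≤ A + (1 + C) * ε := by
      have h1 := abs_colourMean_sub_le (a := a) (α := α) hclose i (w.1 s)
      have h2 : |(∫ r', J (r - r') * m i s r') - ∫ r', g r' * m i s r'| ≤ ε * C := by
        rw [← integral_sub (hm.integrable_mul hJr i s) (hm.integrable_mul (hFc g hg) i s)]
        simp only [← sub_mul]
        exact abs_integral_mul_le (hC i s) hε hclose
      have h3 := hA i g hg
      simp only [hdev] at h3
      rw [abs_le] at *
      constructor <;> linarith [h1.1, h1.2, h2.1, h2.2, h3.1, h3.2]
    rw [kacField_eq_colourMean ha hα, hm.limitField_eq hJ]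
    have h1 := key 0
    have h2 := key 1
    rw [abs_le] at *
    constructor <;> linarith [h1.1, h1.2, h2.1, h2.2]
  have hrate (A : ℝ) (s : Time T) (hA : ∀ i, ∀ g ∈ F, |dev i g s| ≤ A) (i : Fin 2)
      (g : Torus d → ℝ) (hg : g ∈ F) :
      |generator J θ α (colourMean a α i g) (w.1 s) - limitDrift J θ a p m i g s| ≤
        (1 + 2 * B) * A + c * ε := by
    rw [generator_colourMean hJs, hm.limitDrift_eq hJ i (hFc g hg)]
    have h1 := hA i g hg
    simp only [hdev] at h1
    have h2 := hdrift i g hg (w.1 s)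
    have hu : Measurable fun r => limitField J m s r + a i * θ :=
      ((hm.measurable_limitField hJ).comp (measurable_const.prodMk measurable_id)).add_const _
    have h3 : |(p i * ∫ r, g r * Real.tanh (kacField J (w.1 s) r + a i * θ)) -
        p i * ∫ r, g r * Real.tanh (limitField J m s r + a i * θ)| ≤
        B * (2 * A + 2 * (1 + C) * ε) := by
      rw [← mul_sub, abs_mul, abs_of_nonneg (hp i)]
      refine (mul_le_of_le_one_left (abs_nonneg _) (hp_le i)).trans ?_
      refine abs_integral_sub_le (integrable_mul_tanh (hFc g hg)
        ((continuous_kacField hJ (w.1 s)).measurable.add_const _))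
        (integrable_mul_tanh (hFc g hg) hu) fun r => ?_
      refine abs_mul_tanh_sub_le hB (hFB g hg r) ?_
      rw [add_sub_add_right_eq_sub]
      exact hfield A s hA r
    rw [hc]
    rw [abs_le] at *
    constructor <;> linarith [h1.1, h1.2, h2.1, h2.2, h3.1, h3.2]
  have hlim (i : Fin 2) (g : Torus d → ℝ) (hg : g ∈ F) (u v : ℝ) : IntervalIntegrable
      (fun s => limitDrift J θ a p m i g (Set.projIcc 0 T hT.le s)) volume u v := by
    refine intervalIntegrable_of_bounded ((hm.measurable_limitDrift hJ i (hFc g hg)).comp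
      (continuous_projIcc (h := hT.le)).measurable) (B := B * (C + 1)) (fun s => ?_) u v
    refine abs_integral_mul_le ?_ hB (hFB g hg)
    filter_upwards [hC i (Set.projIcc 0 T hT.le s)] with r hr
    refine (abs_add_le _ _).trans (add_le_add (by rwa [abs_neg]) ?_)
    rw [abs_mul, abs_of_nonneg (hp i)]
    exact mul_le_one₀ (hp_le i) (abs_nonneg _) (abs_tanh_le_one _)
  -- The weak equation is subtracted from the Dynkin decomposition.
  have hduhamel (i : Fin 2) (g : Torus d → ℝ) (hg : g ∈ F) (t : Time T) :
      dev i g t = (colourMean a α i g (w.1 (timeZero hT)) - p i * ∫ r, g r * m₀ r) +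
        dynkin hT (colourMean a α i g) (generator J θ α (colourMean a α i g)) t w +
        ∫ s in (0 : ℝ)..t, (generator J θ α (colourMean a α i g) (evalAt hT w s) -
          limitDrift J θ a p m i g (Set.projIcc 0 T hT.le s)) := by
    rw [intervalIntegral.integral_sub (intervalIntegrable_evalAt hT _ w _ _) (hlim i g hg _ _),
      dynkin_coe]
    simp only [hdev]
    rw [hm.integral_mul_eq hT i (hFc g hg) t]
    change _ = _ + (_ - _ - pathIntegral hT _ t w) + (pathIntegral hT _ t w - _)
    ring
  have hstep (A : ℝ) (hA0 : 0 ≤ A)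
      (hA : ∀ i, ∀ g ∈ F, ∀ t : Time T, |dev i g t| ≤ A * Real.exp (l * t)) :
      ∀ i, ∀ g ∈ F, ∀ t : Time T, |dev i g t| ≤ (η + A / 2) * Real.exp (l * t) := by
    intro i g hg t
    have h1 : |∫ s in (0 : ℝ)..t, (generator J θ α (colourMean a α i g) (evalAt hT w s) -
        limitDrift J θ a p m i g (Set.projIcc 0 T hT.le s))| ≤
        A / 2 * Real.exp (l * t) + c * ε * T := by
      have h2 := intervalIntegral.norm_integral_le_of_norm_le t.2.1 (μ := volume)
        (f := fun s => generator J θ α (colourMean a α i g) (evalAt hT w s) -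
          limitDrift J θ a p m i g (Set.projIcc 0 T hT.le s))
        (g := fun s => (1 + 2 * B) * A * Real.exp (l * s) + c * ε)
        (.of_forall fun s hs => by
          have h3 := hrate (A * Real.exp (l * (Set.projIcc 0 T hT.le s : Time T)))
            (Set.projIcc 0 T hT.le s) (fun i g hg => hA i g hg _) i g hg
          rw [Set.projIcc_of_mem hT.le ⟨hs.1.le, hs.2.trans t.2.2⟩] at h3
          rw [evalAt, Set.projIcc_of_mem hT.le ⟨hs.1.le, hs.2.trans t.2.2⟩, Real.norm_eq_abs,
            mul_assoc]
          exact h3)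
        (Continuous.intervalIntegrable (by fun_prop) _ _)
      rw [integral_const_mul_exp_add hl0] at h2
      refine h2.trans (add_le_add ?_ (mul_le_mul_of_nonneg_left t.2.2 (by positivity)))
      have h4 : (1 + 2 * B) * A * ((Real.exp (l * t) - 1) / l) =
          A / 2 * (Real.exp (l * t) - 1) := by
        rw [hl]; field_simp
      rw [h4]
      exact mul_le_mul_of_nonneg_left (by linarith) (by positivity)
    have h5 : 1 ≤ Real.exp (l * t) := Real.one_le_exp (mul_nonneg hl0.le t.2.1)
    have h6 : η ≤ η * Real.exp (l * t) := le_mul_of_one_le_right hη0 h5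
    have h7 := hinit i g hg
    have h8 := hmart i g hg t
    rw [hduhamel i g hg t]
    refine (abs_add_three _ _ _).trans ?_
    rw [add_mul]
    have h9 : η = 2 * ε + c * ε * T := by rw [hη]; ring
    linarith
  refine le_of_halving (P := fun A => ∀ i, ∀ g ∈ F, ∀ t : Time T,
    |dev i g t| ≤ A * Real.exp (l * t)) (A := B + B * C) (η := η)
    (c := Real.exp (l * T)) (by positivity) hη0 (fun i g hg t => ?_) hstep
    (fun A hA => ?_) ?_
  · refine (hcrude i g hg t).trans ?_
    have h5 : 1 ≤ Real.exp (l * t) := Real.one_le_exp (mul_nonneg hl0.le t.2.1)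
    have h6 : 0 ≤ B + B * C := by positivity
    nlinarith
  · have h := hA i g hg t
    have hA0 : 0 ≤ A := nonneg_of_mul_nonneg_left ((abs_nonneg _).trans h) (Real.exp_pos _)
    refine h.trans (mul_le_mul_of_nonneg_left (Real.exp_le_exp.2 ?_) hA0)
    exact mul_le_mul_of_nonneg_left t.2.2 hl0.le
  · rw [stabilityConst, hη, hc, hl]; ring

end Gronwall

/-! ### Almost sure properties of the random field -/

section Field

variable {d : ℕ} {a p : Fin 2 → ℝ} {α : (Fin d → ℤ) → ℝ}

theorem ae_forall_field_eq_or (hp : ∀ i, 0 ≤ p i) (hp1 : p 0 + p 1 = 1) :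
    ∀ᵐ α ∂(disorderLaw d a p), ∀ z, α z = a 0 ∨ α z = a 1 := by
  have := isProbabilityMeasure_siteLaw a p hp hp1
  refine ae_all_iff.2 fun z => ?_
  have hmp : MeasurePreserving (Function.eval z) (disorderLaw d a p) (siteLaw a p) :=
    measurePreserving_eval_infinitePi _ _
  have h : ∀ᵐ u ∂(siteLaw a p), u = a 0 ∨ u = a 1 := by
    rw [ae_iff]
    simp [siteLaw, Fin.sum_univ_two]
  exact hmp.quasiMeasurePreserving.ae h

theorem tendsto_siteMean_colour {i : Fin 2} {s : (k : ℕ) → Site d (2 * k + 1) → ℝ} {L : ℝ}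
    {g : Torus d → ℝ}
    (hα : Tendsto (fun k => siteMean fun x =>
      g (toTorus x) * s k x * (colour (2 * k + 1) a α i x - p i)) atTop (𝓝 0))
    (hL : Tendsto (fun k => siteMean fun x => g (toTorus x) * s k x) atTop (𝓝 L)) :
    Tendsto (fun k => siteMean fun x => g (toTorus x) * colour (2 * k + 1) a α i x * s k x) atTop
      (𝓝 (p i * L)) := by
  have h := hα.add (hL.const_mul (p i))
  rw [zero_add] at h
  refine h.congr fun k => ?_
  rw [← siteMean_const_mul, ← siteMean_add]
  congr 1
  funext x
  ring

end Field

/-! ### Finite nets of test functions -/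

/-- Uniform continuity on the compact product makes nearby parameters give uniformly close
functions. It is used for $r\mapsto J(r-\cdot)$ and for $t\mapsto G_i(t,\cdot)$; joint continuity is
thus enough to handle the time dependence of $G$. -/
theorem exists_finite_net {d : ℕ} {X : Type*} [PseudoMetricSpace X] [CompactSpace X]
    {Φ : X → Torus d → ℝ} (hΦ : Continuous fun q : X × Torus d => Φ q.1 q.2) {ε : ℝ} (hε : 0 < ε) :
    ∃ t : Set X, t.Finite ∧ ∀ x, ∃ y ∈ t, ∀ r, |Φ x r - Φ y r| ≤ ε := by
  obtain ⟨η, hη, h⟩ := Metric.uniformContinuous_iff.1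
    (CompactSpace.uniformContinuous_of_continuous hΦ) ε hε
  obtain ⟨t, -, ht, hcov⟩ := finite_cover_balls_of_compact (isCompact_univ (X := X)) hη
  refine ⟨t, ht, fun x => ?_⟩
  obtain ⟨y, hy, hxy⟩ := Set.mem_iUnion₂.1 (hcov (Set.mem_univ x))
  refine ⟨y, hy, fun r => (h (a := (x, r)) (b := (y, r)) ?_).le⟩
  rw [Prod.dist_eq, dist_self]
  exact max_lt hxy hη

theorem exists_abs_le_of_continuous_uncurry {d : ℕ} {X : Type*} [TopologicalSpace X]
    [CompactSpace X] {Φ : X → Torus d → ℝ} (hΦ : Continuous fun q : X × Torus d => Φ q.1 q.2) :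
    ∃ B, ∀ x r, |Φ x r| ≤ B := by
  obtain ⟨B, hB⟩ := (isCompact_range hΦ.abs).bddAbove
  exact ⟨B, fun x r => hB ⟨(x, r), rfl⟩⟩

/-! ### Fluctuations of the coloured empirical measures -/

theorem IsGlauberLaw.measure_exists_lt_abs_dynkin_le {d n : ℕ} [NeZero n] {T : ℝ} {hT : 0 < T}
    {J : Torus d → ℝ} {θ : ℝ} {a : Fin 2 → ℝ} {α : (Fin d → ℤ) → ℝ} {σ₀ : Config d n}
    {μ : Measure (PathSpace T (Config d n))} (hμ : IsGlauberLaw hT J θ α σ₀ μ)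
    (hJs : ∀ r, J (-r) = J r) {g : Torus d → ℝ} {B : ℝ} (hg : ∀ r, |g r| ≤ B) (i : Fin 2)
    {ε : ℝ} (hε : 0 < ε) :
    μ {w | ∃ t : Time T, ε < |dynkin hT (colourMean a α i g)
      (generator J θ α (colourMean a α i g)) t w|} ≤
      ENNReal.ofReal (√(T * (((n : ℝ)⁻¹) ^ d * (2 * B) ^ 2)) / ε) := by
  have := hμ.isProbabilityMeasure
  have hM (f : Config d n → ℝ) : Martingale (fun (t : Time T) => dynkin hT f (generator J θ α f) t)
      (canonicalFiltration T (Config d n)) μ := by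
    have h := hμ.martingale f
    convert h using 1
    funext t w
    exact dynkin_coe hT f _ t w
  exact KacGlauber.measure_exists_lt_abs_dynkin_le hμ.initial (hM _) (hM _)
    (carre_du_champ_colourMean_le hJs hg i) hε

theorem tendsto_fluctuationBound {d : ℕ} (hd : 1 ≤ d) (T B ε : ℝ) (N : ENNReal) (hN : N ≠ ⊤) :
    Tendsto (fun k : ℕ => N * ENNReal.ofReal
      (√(T * ((((2 * k + 1 : ℕ) : ℝ)⁻¹) ^ d * (2 * B) ^ 2)) / ε)) atTop (𝓝 0) := by
  have h1 := ((tendsto_inv_odd.pow d).mul_const ((2 * B) ^ 2)).const_mul T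
  have h2 := (Real.continuous_sqrt.tendsto _).comp h1
  have h3 := (ENNReal.tendsto_ofReal (h2.div_const ε))
  have h4 := ENNReal.Tendsto.const_mul (a := N) h3 (Or.inr hN)
  simpa [zero_pow (show d ≠ 0 by omega)] using h4

/-! ### The hydrodynamic limit for a fixed realization of the field -/

theorem tendsto_measure_iSup_ge {d : ℕ} (hd : 1 ≤ d) {T : ℝ} (hT : 0 < T) {J : Torus d → ℝ}
    (hJ : Continuous J) (hJs : ∀ r, J (-r) = J r) {θ : ℝ} {a p : Fin 2 → ℝ} (ha : a 0 ≠ a 1)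
    (hp : ∀ i, 0 ≤ p i) (hp_le : ∀ i, p i ≤ 1) {m₀ : Torus d → ℝ}
    {σ₀ : (k : ℕ) → Config d (2 * k + 1)} {m : Fin 2 → Time T → Torus d → ℝ}
    (hm : IsWeakSolution J θ a p m₀ m) {α : (Fin d → ℤ) → ℝ} (hα : ∀ z, α z = a 0 ∨ α z = a 1)
    (hfield : ∀ (i : Fin 2) (g : Torus d → ℝ), Continuous g → Tendsto
      (fun k => siteMean fun x => g (toTorus x) * colour (2 * k + 1) a α i x) atTop
      (𝓝 (p i * ∫ r, g r)))
    (hinit : ∀ (i : Fin 2) (g : Torus d → ℝ), Continuous g → Tendsto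
      (fun k => colourMean a α i g (σ₀ k)) atTop (𝓝 (p i * ∫ r, g r * m₀ r)))
    {P : (k : ℕ) → Measure (PathSpace T (Config d (2 * k + 1)))}
    (hP : ∀ k, IsGlauberLaw hT J θ α (σ₀ k) (P k)) {G : Fin 2 → Time T → Torus d → ℝ}
    (hG : ∀ i, Continuous fun q : Time T × Torus d => G i q.1 q.2) {δ : ℝ} (hδ : 0 < δ) :
    Tendsto (fun k => P k {w | ENNReal.ofReal δ ≤ ⨆ t : Time T,
      ‖colouredEmpirical a α (w.1 t) (fun i => G i t) -
        pairing (fun i => m i t) (fun i => G i t)‖ₑ}) atTop (𝓝 0) := by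
  obtain ⟨C', hC'⟩ := hm.bounded
  set C := max C' 0
  have hC0 : 0 ≤ C := le_max_right _ _
  have hC : ∀ i t, ∀ᵐ r, |m i t r| ≤ C := fun i t => by
    filter_upwards [hC' i t] with r hr using hr.trans (le_max_left _ _)
  obtain ⟨B₀, hB₀, hJB⟩ := exists_abs_le_of_continuous hJ
  choose B' hGB using fun i => exists_abs_le_of_continuous_uncurry (hG i)
  set B := max B₀ (max (B' 0) (B' 1))
  have hB : 0 ≤ B := le_max_of_le_left hB₀
  -- The extra $1+C$ pays for replacing $G_i(t)$ by a net element, once against $\pi_i$ and once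
  -- against $m_i$.
  set K := stabilityConst B C T + (1 + C)
  have hK : 0 < K := by
    have : 0 ≤ stabilityConst B C T := by unfold stabilityConst; positivity
    positivity
  -- Each colour contributes at most $K\varepsilon=\delta/4$, so off the bad events the supremum is
  -- at most $\delta/2<\delta$.
  set ε := δ / (4 * K)
  have hε : 0 < ε := by positivity
  have hJ2 : Continuous fun q : Torus d × Torus d => J (q.1 - q.2) := by fun_prop
  obtain ⟨tJ, htJ, hnetJ⟩ := exists_finite_net (Φ := fun r r' : Torus d => J (r - r')) hJ2 hε
  choose tG htG hnetG using fun i => exists_finite_net (hG i) hε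
  set F : Set (Torus d → ℝ) := (fun (r r' : Torus d) => J (r - r')) '' tJ ∪ ⋃ i, G i '' tG i
  have hF : F.Finite :=
    (htJ.image _).union (Set.finite_iUnion fun i => (htG i).image _)
  have hFc : ∀ g ∈ F, Continuous g := by
    rintro g (⟨r, -, rfl⟩ | hg)
    · exact hJ2.comp (Continuous.prodMk_right r)
    · obtain ⟨i, t, -, rfl⟩ := Set.mem_iUnion.1 hg
      exact (hG i).comp (Continuous.prodMk_right t)
  have hFB : ∀ g ∈ F, ∀ r, |g r| ≤ B := by
    rintro g (⟨r, -, rfl⟩ | hg) r'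
    · exact (hJB _).trans (le_max_left _ _)
    · obtain ⟨i, t, -, rfl⟩ := Set.mem_iUnion.1 hg
      refine (hGB i t r').trans (le_max_of_le_right ?_)
      fin_cases i
      · exact le_max_left _ _
      · exact le_max_right _ _
  have hnet : ∀ r, ∃ g ∈ F, ∀ r', |J (r - r') - g r'| ≤ ε := by
    intro r
    obtain ⟨y, hy, h⟩ := hnetJ r
    exact ⟨_, Or.inl ⟨y, hy, rfl⟩, h⟩
  have hev1 : ∀ᶠ k in atTop, ∀ i, ∀ g ∈ F,
      |colourMean a α i g (σ₀ k) - p i * ∫ r, g r * m₀ r| ≤ ε := by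
    refine eventually_all.2 fun i => (eventually_all_finite hF).2 fun g hg => ?_
    filter_upwards [Metric.tendsto_nhds.1 (hinit i g (hFc g hg)) ε hε] with k hk
    rw [Real.dist_eq] at hk
    exact hk.le
  have hev2 : ∀ᶠ k in atTop, ∀ i, ∀ g ∈ F, ∀ σ : Config d (2 * k + 1),
      |colourDrift J θ a α i g σ - p i * ∫ r, g r * Real.tanh (kacField J σ r + a i * θ)| ≤ ε :=
    eventually_all.2 fun i => (eventually_all_finite hF).2 fun g hg =>
      eventually_forall_abs_colourDrift_sub_le hd hJ (hp i) (hp_le i) (hfield i) (hFc g hg) hε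
  refine tendsto_of_tendsto_of_tendsto_of_le_of_le' tendsto_const_nhds
    (tendsto_fluctuationBound hd T B ε (2 * hF.toFinset.card)
      (ENNReal.mul_ne_top (by simp) (by simp))) (.of_forall fun _ => zero_le) ?_
  filter_upwards [hev1, hev2] with k hk1 hk2
  set bad : Fin 2 → (Torus d → ℝ) → Set (PathSpace T (Config d (2 * k + 1))) := fun i g =>
    {w | ∃ t : Time T, ε < |dynkin hT (colourMean a α i g)
      (generator J θ α (colourMean a α i g)) t w|} with hbad
  -- Only monotonicity of the measure is applied to this inclusion, so measurability of the supremum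
  -- over all times is not required.
  have hsub : {w | ENNReal.ofReal δ ≤ ⨆ t : Time T,
      ‖colouredEmpirical a α (w.1 t) (fun i => G i t) -
        pairing (fun i => m i t) (fun i => G i t)‖ₑ} ⊆
      {w : PathSpace T (Config d (2 * k + 1)) | w.1 (timeZero hT) ≠ σ₀ k} ∪
        ⋃ i ∈ (Finset.univ : Finset (Fin 2)), ⋃ g ∈ hF.toFinset, bad i g := by
    intro w hw
    by_contra hnot
    simp only [Set.mem_union, Set.mem_ofPred_eq, Set.mem_iUnion, not_or, not_not, not_exists,
      Finset.mem_univ, true_implies, Set.Finite.mem_toFinset, hbad, not_lt] at hnot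
    obtain ⟨h0, hgood⟩ := hnot
    have hstab (i : Fin 2) {g : Torus d → ℝ} (hg : g ∈ F) (t : Time T) :=
      abs_colourMean_sub_le_stabilityConst hT hJ hJs ha hp hp_le hα hm hC0 hC w hε.le hB hFc hFB
        hnet (by rw [h0]; exact hk1) hgood hk2 i hg t
    have hterm (i : Fin 2) (t : Time T) :
        |colourMean a α i (G i t) (w.1 t) - ∫ r, G i t r * m i t r| ≤ K * ε := by
      obtain ⟨s, hs, hclose⟩ := hnetG i t
      have h1 := hstab i (g := G i s) (Or.inr (Set.mem_iUnion.2 ⟨i, s, hs, rfl⟩)) t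
      have h2 := abs_colourMean_sub_le (a := a) (α := α) hclose i (w.1 t)
      have hc (t : Time T) : Continuous (G i t) := (hG i).comp (Continuous.prodMk_right t)
      have h3 : |(∫ r, G i t r * m i t r) - ∫ r, G i s r * m i t r| ≤ ε * C := by
        rw [← integral_sub (hm.integrable_mul (hc t) i t) (hm.integrable_mul (hc s) i t)]
        simp only [← sub_mul]
        exact abs_integral_mul_le (hC i t) hε.le hclose
      have hKε : K * ε = stabilityConst B C T * ε + ε + ε * C := by simp only [K]; ring
      rw [hKε]
      rw [abs_le] at *
      constructor <;> linarith [h1.1, h1.2, h2.1, h2.2, h3.1, h3.2]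
    have hsup : (⨆ t : Time T, ‖colouredEmpirical a α (w.1 t) (fun i => G i t) -
        pairing (fun i => m i t) (fun i => G i t)‖ₑ) ≤ ENNReal.ofReal (δ / 2) := by
      refine iSup_le fun t => ?_
      rw [Real.enorm_eq_ofReal_abs]
      refine ENNReal.ofReal_le_ofReal ?_
      have hsum : colouredEmpirical a α (w.1 t) (fun i => G i t) -
          pairing (fun i => m i t) (fun i => G i t) =
          (colourMean a α 0 (G 0 t) (w.1 t) - ∫ r, G 0 t r * m 0 t r) +
          (colourMean a α 1 (G 1 t) (w.1 t) - ∫ r, G 1 t r * m 1 t r) := by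
        simp only [colouredEmpirical, pairing, Fin.sum_univ_two, colourMean, siteMean]
        ring
      have hKε : K * ε = δ / 4 := by simp only [ε]; field_simp
      rw [hsum]
      refine (abs_add_le _ _).trans ((add_le_add (hterm 0 t) (hterm 1 t)).trans ?_)
      rw [hKε]; linarith
    have := le_trans (show ENNReal.ofReal δ ≤ _ from hw) hsup
    rw [ENNReal.ofReal_le_ofReal_iff (by positivity)] at this
    linarith
  have hnull : P k {w : PathSpace T (Config d (2 * k + 1)) | w.1 (timeZero hT) ≠ σ₀ k} = 0 :=
    ae_iff.1 (hP k).initial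
  calc _ ≤ P k {w : PathSpace T (Config d (2 * k + 1)) | w.1 (timeZero hT) ≠ σ₀ k} +
        P k (⋃ i ∈ (Finset.univ : Finset (Fin 2)), ⋃ g ∈ hF.toFinset, bad i g) :=
        (measure_mono hsub).trans (measure_union_le _ _)
    _ ≤ 0 + ∑ i : Fin 2, ∑ g ∈ hF.toFinset, P k (bad i g) := by
        rw [hnull]
        refine add_le_add le_rfl ((measure_biUnion_finset_le _ _).trans ?_)
        exact Finset.sum_le_sum fun i _ => measure_biUnion_finset_le _ _
    _ ≤ 0 + ∑ _i : Fin 2, ∑ _g ∈ hF.toFinset, ENNReal.ofReal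
          (√(T * ((((2 * k + 1 : ℕ) : ℝ)⁻¹) ^ d * (2 * B) ^ 2)) / ε) := by
        refine add_le_add le_rfl (Finset.sum_le_sum fun i _ => Finset.sum_le_sum fun g hg => ?_)
        exact (hP k).measure_exists_lt_abs_dynkin_le hJs (hFB g (hF.mem_toFinset.1 hg)) i hε
    _ = _ := by
        simp only [Finset.sum_const, Finset.card_univ, Fintype.card_fin, nsmul_eq_mul, zero_add]
        rw [← mul_assoc]
        norm_cast

end

end KacGlauber

/-- Uniform-in-time hydrodynamic limit of the coloured empirical measures, along
`γ = 1/(2k+1) → 0`, for almost every realization of the random field. -/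
theorem corollary2p7 (d : ℕ) (hd : 1 ≤ d) (T : ℝ) (hT : 0 < T)
    (J : KacGlauber.Torus d → ℝ) (hJ : KacGlauber.IsC1 J) (hJsymm : ∀ r, J (-r) = J r)
    (hJint : ∫ r, J r = 1)
    (θ : ℝ) (hθ : 0 < θ) (a p : Fin 2 → ℝ) (ha : a 0 ≠ a 1)
    (hp : ∀ i, 0 ≤ p i) (hp1 : p 0 + p 1 = 1)
    (m₀ : KacGlauber.Torus d → ℝ) (hm₀ : Continuous m₀) (hm₀_le : ∀ r, |m₀ r| ≤ 1)
    (σ₀ : (k : ℕ) → KacGlauber.Config d (2 * k + 1))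
    (hσ₀ : ∀ g : KacGlauber.Torus d → ℝ, Continuous g →
      Tendsto (fun k => KacGlauber.empirical (σ₀ k) g) atTop (𝓝 (∫ r, g r * m₀ r)))
    (m : Fin 2 → KacGlauber.Time T → KacGlauber.Torus d → ℝ)
    (hm : KacGlauber.IsWeakSolution J θ a p m₀ m) :
    ∀ᵐ α ∂(KacGlauber.disorderLaw d a p),
      ∀ P : (k : ℕ) → Measure (KacGlauber.PathSpace T (KacGlauber.Config d (2 * k + 1))),
        (∀ k, KacGlauber.IsGlauberLaw hT J θ α (σ₀ k) (P k)) →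
        ∀ G : Fin 2 → KacGlauber.Time T → KacGlauber.Torus d → ℝ, (∀ i, KacGlauber.IsC01 (G i)) →
        ∀ δ : ℝ, 0 < δ →
          Tendsto
            (fun k => P k {w | ENNReal.ofReal δ ≤ ⨆ t : KacGlauber.Time T,
              ‖KacGlauber.colouredEmpirical a α (w.1 t) (fun i => G i t)
                - KacGlauber.pairing (fun i => m i t) (fun i => G i t)‖ₑ})
            atTop (𝓝 0) := by
  have hp_le := KacGlauber.le_one_of_add_eq_one hp hp1
  have hJc := hJ.continuous
  -- Weight $1$ gives the colour densities $p_i$ used for the drift; the initial spins, which do not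
  -- depend on $\alpha$, give the coloured initial profile $p_im_0$.
  filter_upwards [KacGlauber.ae_forall_field_eq_or hp hp1,
    KacGlauber.ae_forall_tendsto_siteMean_centred hd ha hp hp1 (fun _ _ => 1) (by simp),
    KacGlauber.ae_forall_tendsto_siteMean_centred hd ha hp hp1 (fun k => KacGlauber.spin (σ₀ k))
      fun k x => (KacGlauber.abs_spin _ _).le] with α h1 h2 h3 P hP G hG δ hδ
  refine KacGlauber.tendsto_measure_iSup_ge hd hT hJc hJsymm ha hp hp_le hm h1
    (fun i g hg => ?_) (fun i g hg => ?_) hP (fun i => (hG i).1) hδ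
  · have h := KacGlauber.tendsto_siteMean_colour (h2 i g hg)
      (by simpa only [mul_one] using KacGlauber.tendsto_siteMean hg)
    simpa only [mul_one] using h
  · exact KacGlauber.tendsto_siteMean_colour (h3 i g hg) (hσ₀ g hg)
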